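/- Let $E$ be a (real) Banach lattice, let $k$ be a positive integer and let $1\le p<\infty$. A sequence $(x_n)_n$ in $E$ is disjoint if $|x_m|\wedge|x_n|=0$ whenever $m\neq n$, and weakly $p$-summable if $\sum_n|x^*(x_n)|^p<\infty$ for every $x^*\in E^*$. A map from $E$ to a Banach space is disjoint $p$-convergent if it sends disjoint weakly $p$-summable sequences to norm null sequences. $E$ has the disjoint Dunford–Pettis property of order $p$ (disjoint $DPP_p$) if for every disjoint weakly $p$-summable sequence $(x_n)_n$ in $E$, every weakly null sequence in $E^*$ converges to zero uniformly on $\{x_n:n\in\mathbb N\}$. A $k$-homogeneous polynomial $P$ between Banach lattices is positive if its associated symmetric $k$-linear operator takes nonnegative values on $k$-tuples of nonnegative vectors, and it is weakly compact if it maps the closed unit ball onto a relatively weakly compact set. $\mathcal P^r(^kE)$ denotes the Banach lattice of all differences of two positive scalar-valued $k$-homogeneous polynomials on $E$, ordered by the cone of positive polynomials and normed by $\|P\|_r=\||P|\|=\sup_{\|x\|\le 1}\bigl||P|(x)\bigr|$. The following statements are equivalent. (a) $E$ has the disjoint $DPP_p$. (b) For any Banach lattice $F$ with order continuous norm, every positive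 weakly compact $k$-homogeneous polynomial $P\colon E\to F$ is disjoint $p$-convergent. (c) Every positive weakly compact $k$-homogeneous polynomial $P\colon E\to c_0$ is disjoint $p$-convergent. (d) For every disjoint weakly $p$-summable sequence $(x_n)_n$ in $E$ and every positive weakly null sequence $(P_n)_n$ in $\mathcal P^r(^kE)$, $P_n(x_n)\to 0$. (e) For every disjoint weakly $p$-summable sequence $(x_n)_n$ in $E$ and every positive disjoint weakly null sequence $(P_n)_n$ in $\mathcal P^r(^kE)$, $P_n(x_n)\to 0$. (f) For every disjoint weakly $p$-summable sequence $(x_n)_n$ in $E$ and every disjoint weakly null sequence $(P_n)_n$ in $\mathcal P^r(^kE)$, $P_n(x_n)\to 0$. -/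

import Mathlib

open Filter Topology
open scoped ZeroAtInfty

noncomputable section

/-! ### The Banach lattice `c₀ = C₀(ℕ, ℝ)`, with the coordinatewise order -/

section CZero

variable {α : Type*} [TopologicalSpace α]

instance : Max C₀(α, ℝ) where
  max f g :=
    { toFun := fun a => f a ⊔ g a
      continuous_toFun := (map_continuous f).sup (map_continuous g)
      zero_at_infty' := by
        simpa using (zero_at_infty f).sup_nhds (zero_at_infty g) }

instance : Min C₀(α, ℝ) where
  min f g :=
    { toFun := fun a => f a ⊓ g a
      continuous_toFun := (map_continuous f).inf (map_continuous g)
      zero_at_infty' := by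
        simpa using (zero_at_infty f).inf_nhds (zero_at_infty g) }

instance : PartialOrder C₀(α, ℝ) := PartialOrder.lift (fun f => (f : α → ℝ)) DFunLike.coe_injective

instance : Lattice C₀(α, ℝ) :=
  { (inferInstance : PartialOrder C₀(α, ℝ)) with
    sup := fun f g => f ⊔ g
    inf := fun f g => f ⊓ g
    le_sup_left := fun _ _ _ => le_sup_left
    le_sup_right := fun _ _ _ => le_sup_right
    sup_le := fun _ _ _ h₁ h₂ a => sup_le (h₁ a) (h₂ a)
    inf_le_left := fun _ _ _ => inf_le_left
    inf_le_right := fun _ _ _ => inf_le_right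
    le_inf := fun _ _ _ h₁ h₂ a => le_inf (h₁ a) (h₂ a) }

instance : IsOrderedAddMonoid C₀(α, ℝ) where
  add_le_add_left _ _ h c a := by simpa using h a

instance : IsOrderedModule ℝ C₀(α, ℝ) where
  smul_le_smul_of_nonneg_left _ hc _ _ h a := mul_le_mul_of_nonneg_left (h a) hc
  smul_le_smul_of_nonneg_right _ hf _ _ h a := mul_le_mul_of_nonneg_right h (hf a)

instance : HasSolidNorm C₀(α, ℝ) where
  solid f g h := by
    rw [← ZeroAtInftyContinuousMap.norm_toBCF_eq_norm, ← ZeroAtInftyContinuousMap.norm_toBCF_eq_norm]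
    refine (BoundedContinuousFunction.norm_le (norm_nonneg _)).2 fun a => ?_
    exact le_trans (h a) (g.toBCF.norm_coe_le_norm a)

end CZero

/-! ### Sequences in normed spaces and Banach lattices -/

section Sequences

/-- `(v n)` is weakly null in the normed space `V`. -/
def WeaklyNull {V : Type*} [NormedAddCommGroup V] [NormedSpace ℝ V] (v : ℕ → V) : Prop :=
  ∀ φ : V →L[ℝ] ℝ, Tendsto (fun n => φ (v n)) atTop (𝓝 0)

/-- `(x n)` is weakly `p`-summable: `∑ |x*(x n)| ^ p < ∞` for every `x*` in the dual. -/
def WeaklyPSummable {X : Type*} [NormedAddCommGroup X] [NormedSpace ℝ X] (p : ℝ)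
    (x : ℕ → X) : Prop :=
  ∀ f : X →L[ℝ] ℝ, Summable fun n => |f (x n)| ^ p

/-- `(x n)` consists of pairwise disjoint elements of the vector lattice `E`. -/
def DisjointSeq {E : Type*} [AddCommGroup E] [Lattice E] (x : ℕ → E) : Prop :=
  ∀ m n, m ≠ n → |x m| ⊓ |x n| = 0

/-- `A` is a Dunford-Pettis set: weakly null sequences of the dual converge to zero uniformly
on `A`. -/
def IsDunfordPettisSet {X : Type*} [NormedAddCommGroup X] [NormedSpace ℝ X] (A : Set X) : Prop :=
  ∀ f : ℕ → (X →L[ℝ] ℝ), WeaklyNull f → TendstoUniformlyOn (fun n x => f n x) 0 atTop A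

/-- The disjoint Dunford-Pettis property of order `p`. -/
def DisjointDPP (p : ℝ) (E : Type*) [NormedAddCommGroup E] [NormedSpace ℝ E] [Lattice E] : Prop :=
  ∀ x : ℕ → E, DisjointSeq x → WeaklyPSummable p x → IsDunfordPettisSet (Set.range x)

/-- A (not necessarily linear) map is disjoint `p`-convergent if it maps disjoint weakly
`p`-summable sequences to norm null sequences. -/
def DisjointPConvergent (p : ℝ) {E Y : Type*} [NormedAddCommGroup E] [NormedSpace ℝ E] [Lattice E]
    [NormedAddCommGroup Y] (P : E → Y) : Prop :=
  ∀ x : ℕ → E, DisjointSeq x → WeaklyPSummable p x → Tendsto (fun n => P (x n)) atTop (𝓝 0)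

/-- The norm of `F` is order continuous: `x_α ↓ 0` implies `‖x_α‖ → 0`. (The norm is monotone on
the positive cone, so decreasing nets may be replaced with downward directed sets.) -/
def OrderContinuousNorm (F : Type*) [NormedAddCommGroup F] [Lattice F] : Prop :=
  ∀ D : Set F, D.Nonempty → DirectedOn (· ≥ ·) D → IsGLB D 0 → ∀ ε > 0, ∃ x ∈ D, ‖x‖ < ε

/-- A map between normed spaces is weakly compact if the image of the closed unit ball is
relatively compact in the weak topology. -/
def WeaklyCompactMap {X Y : Type*} [NormedAddCommGroup X] [NormedAddCommGroup Y] [NormedSpace ℝ Y]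
    (P : X → Y) : Prop :=
  IsCompact (closure (toWeakSpace ℝ Y '' (P '' Metric.closedBall 0 1)))

end Sequences

/-! ### Positive and regular homogeneous polynomials -/

section Polynomials

/-- `P` is a positive `k`-homogeneous polynomial: `P x = T (x, …, x)` where `T`, the (unique)
symmetric `k`-linear map associated with `P`, is positive. As usual polynomials between normed
spaces are continuous; on Banach lattices positivity implies this. -/
def IsPosHomPoly (k : ℕ) {E F : Type*} [NormedAddCommGroup E] [NormedSpace ℝ E] [PartialOrder E]
    [NormedAddCommGroup F] [NormedSpace ℝ F] [PartialOrder F] (P : E → F) : Prop :=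
  ∃ T : ContinuousMultilinearMap ℝ (fun _ : Fin k => E) F,
    (∀ (σ : Equiv.Perm (Fin k)) (v : Fin k → E), T (fun i => v (σ i)) = T v) ∧
    (∀ v : Fin k → E, (∀ i, 0 ≤ v i) → 0 ≤ T v) ∧
    ∀ x, P x = T (fun _ => x)

variable {k : ℕ} {E : Type*} [NormedAddCommGroup E] [NormedSpace ℝ E] [Lattice E]

theorem IsPosHomPoly.zero : IsPosHomPoly k (0 : E → ℝ) :=
  ⟨0, by simp, by simp, by simp⟩

theorem IsPosHomPoly.add {P Q : E → ℝ} (hP : IsPosHomPoly k P) (hQ : IsPosHomPoly k Q) :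
    IsPosHomPoly k (P + Q) := by
  obtain ⟨T, hT, hT', hP⟩ := hP
  obtain ⟨S, hS, hS', hQ⟩ := hQ
  refine ⟨T + S, fun σ v => ?_, fun v hv => ?_, fun x => ?_⟩
  · simp [hT σ v, hS σ v]
  · simpa using add_nonneg (hT' v hv) (hS' v hv)
  · simp [hP, hQ]

theorem IsPosHomPoly.smul {P : E → ℝ} (hP : IsPosHomPoly k P) {c : ℝ} (hc : 0 ≤ c) :
    IsPosHomPoly k (c • P) := by
  obtain ⟨T, hT, hT', hP⟩ := hP
  refine ⟨c • T, fun σ v => ?_, fun v hv => ?_, fun x => ?_⟩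
  · simp [hT σ v]
  · simpa using mul_nonneg hc (hT' v hv)
  · simp [hP]

theorem abs_map_le_map_abs [IsOrderedAddMonoid E]
    (T : ContinuousMultilinearMap ℝ (fun _ : Fin k => E) ℝ)
    (hT : ∀ v : Fin k → E, (∀ i, 0 ≤ v i) → 0 ≤ T v) (v : Fin k → E) :
    |T v| ≤ T (fun i => |v i|) := by
  suffices H : ∀ (s : Finset (Fin k)) (w : Fin k → E), (∀ i, i ∉ s → 0 ≤ w i) →
      |T w| ≤ T (fun i => |w i|) from H Finset.univ v (by simp)
  intro s
  induction s using Finset.induction_on with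
  | empty =>
    intro w hw
    have h : (fun i => |w i|) = w := funext fun i => abs_of_nonneg (hw i (by simp))
    rw [h, abs_of_nonneg (hT w fun i => hw i (by simp))]
  | insert a s _ ih =>
    intro w hw
    have key : ∀ y : E, 0 ≤ y →
        |T (Function.update w a y)| ≤ T (Function.update (fun i => |w i|) a y) := by
      intro y hy
      have h := ih (Function.update w a y) (fun i hi => by
        by_cases h : i = a
        · subst h; simpa using hy
        · simpa [h] using hw i (by simp [h, hi]))
      have h' : (fun i => |Function.update w a y i|) = Function.update (fun i => |w i|) a y := by
        funext i
        by_cases h : i = a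
        · subst h; simpa using abs_of_nonneg hy
        · simp [h]
      rwa [h'] at h
    have e₁ : T w = T (Function.update w a (w a)⁺) - T (Function.update w a (w a)⁻) := by
      rw [← ContinuousMultilinearMap.map_update_sub, posPart_sub_negPart, Function.update_eq_self]
    have e₂ : T (fun i => |w i|) = T (Function.update (fun i => |w i|) a (w a)⁺)
        + T (Function.update (fun i => |w i|) a (w a)⁻) := by
      rw [← ContinuousMultilinearMap.map_update_add, posPart_add_negPart]
      congr 1
      exact (Function.update_eq_self a (fun i => |w i|)).symm
    rw [e₁, e₂]
    exact (abs_sub _ _).trans (add_le_add (key _ (posPart_nonneg _)) (key _ (negPart_nonneg _)))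

theorem IsPosHomPoly.nonneg {P : E → ℝ} (hP : IsPosHomPoly k P) {x : E} (hx : 0 ≤ x) :
    0 ≤ P x := by
  obtain ⟨T, _, hT', hP⟩ := hP
  rw [hP]
  exact hT' _ fun _ => hx

theorem IsPosHomPoly.abs_le [IsOrderedAddMonoid E] {P : E → ℝ} (hP : IsPosHomPoly k P) (x : E) :
    |P x| ≤ P |x| := by
  obtain ⟨T, _, hT', hP⟩ := hP
  rw [hP, hP]
  exact abs_map_le_map_abs T hT' _

variable (k E) in
/-- The vector space of regular scalar valued `k`-homogeneous polynomials on `E`: the differences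
of two positive ones. -/
def regularPolynomials : Submodule ℝ (E → ℝ) where
  carrier := {P | ∃ P₁ P₂ : E → ℝ, IsPosHomPoly k P₁ ∧ IsPosHomPoly k P₂ ∧ P = P₁ - P₂}
  zero_mem' := ⟨0, 0, .zero, .zero, by simp⟩
  add_mem' := by
    rintro _ _ ⟨P₁, P₂, h₁, h₂, rfl⟩ ⟨Q₁, Q₂, g₁, g₂, rfl⟩
    exact ⟨_, _, h₁.add g₁, h₂.add g₂, by abel⟩
  smul_mem' := by
    rintro c _ ⟨P₁, P₂, h₁, h₂, rfl⟩
    rcases le_total 0 c with hc | hc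
    · exact ⟨_, _, h₁.smul hc, h₂.smul hc, smul_sub _ _ _⟩
    · have hc : 0 ≤ -c := neg_nonneg.2 hc
      exact ⟨_, _, h₂.smul hc, h₁.smul hc, by module⟩

variable (k E) in
/-- The space `𝒫ʳ(ᵏE)` of regular scalar valued `k`-homogeneous polynomials on `E`. It carries the
order given by the positive polynomials (not the pointwise order) and the regular norm. -/
def RegPoly : Type _ := ↥(regularPolynomials k E)

namespace RegPoly

instance : AddCommGroup (RegPoly k E) := inferInstanceAs (AddCommGroup ↥(regularPolynomials k E))

instance : Module ℝ (RegPoly k E) := inferInstanceAs (Module ℝ ↥(regularPolynomials k E))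

instance : FunLike (RegPoly k E) E ℝ where
  coe := fun P : ↥(regularPolynomials k E) => (P : E → ℝ)
  coe_injective := fun _ _ h => Subtype.ext h

@[ext]
theorem ext {P Q : RegPoly k E} (h : ∀ x, P x = Q x) : P = Q := DFunLike.ext _ _ h

@[simp]
theorem zero_apply (x : E) : (0 : RegPoly k E) x = 0 := rfl

@[simp]
theorem add_apply (P Q : RegPoly k E) (x : E) : (P + Q) x = P x + Q x := rfl

@[simp]
theorem sub_apply (P Q : RegPoly k E) (x : E) : (P - Q) x = P x - Q x := rfl

@[simp]
theorem neg_apply (P : RegPoly k E) (x : E) : (-P) x = -P x := rfl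

@[simp]
theorem smul_apply (c : ℝ) (P : RegPoly k E) (x : E) : (c • P) x = c * P x := rfl

theorem exists_eq_sub (P : RegPoly k E) : ∃ P₁ P₂ : E → ℝ, IsPosHomPoly k P₁ ∧ IsPosHomPoly k P₂ ∧
    ∀ x, P x = P₁ x - P₂ x := by
  obtain ⟨P₁, P₂, h₁, h₂, h⟩ := Subtype.property (p := (· ∈ regularPolynomials k E)) P
  exact ⟨P₁, P₂, h₁, h₂, fun x => congrFun h x⟩

/-- A positive `k`-homogeneous polynomial as an element of `𝒫ʳ(ᵏE)`. -/
def ofPos {P : E → ℝ} (hP : IsPosHomPoly k P) : RegPoly k E :=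
  Subtype.mk (p := (· ∈ regularPolynomials k E)) P ⟨P, 0, hP, .zero, by simp⟩

@[simp]
theorem ofPos_apply {P : E → ℝ} (hP : IsPosHomPoly k P) (x : E) : ofPos hP x = P x := rfl

/-- The supremum norm of `P` on the closed unit ball. -/
def supNorm (P : RegPoly k E) : ℝ := ⨆ x : Metric.closedBall (0 : E) 1, |P x|

theorem bddAbove (P : RegPoly k E) :
    BddAbove (Set.range fun x : Metric.closedBall (0 : E) 1 => |P x|) := by
  obtain ⟨P₁, P₂, ⟨T, _, _, hT⟩, ⟨S, _, _, hS⟩, hP⟩ := P.exists_eq_sub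
  have bd : ∀ (R : ContinuousMultilinearMap ℝ (fun _ : Fin k => E) ℝ) (x : E), ‖x‖ ≤ 1 →
      |R fun _ => x| ≤ ‖R‖ := by
    intro R x hx
    refine (R.le_opNorm _).trans ?_
    simpa using mul_le_of_le_one_right (norm_nonneg R) (pow_le_one₀ (norm_nonneg x) hx)
  refine ⟨‖T‖ + ‖S‖, ?_⟩
  rintro _ ⟨⟨x, hx⟩, rfl⟩
  have hx : ‖x‖ ≤ 1 := by simpa using hx
  change |P x| ≤ _
  rw [hP, hT, hS]
  exact (abs_sub _ _).trans (add_le_add (bd T x hx) (bd S x hx))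

theorem abs_apply_le_supNorm (P : RegPoly k E) {x : E} (hx : ‖x‖ ≤ 1) : |P x| ≤ P.supNorm :=
  le_ciSup P.bddAbove ⟨x, by simpa using hx⟩

theorem supNorm_le {P : RegPoly k E} {C : ℝ} (h : ∀ x, ‖x‖ ≤ 1 → |P x| ≤ C) : P.supNorm ≤ C :=
  haveI : Nonempty (Metric.closedBall (0 : E) 1) := ⟨⟨0, by simp⟩⟩
  ciSup_le fun x => h x (mem_closedBall_zero_iff.1 x.2)

theorem supNorm_nonneg (P : RegPoly k E) : 0 ≤ P.supNorm :=
  (abs_nonneg _).trans (P.abs_apply_le_supNorm (x := 0) (by simp))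

theorem map_smul_self (P : RegPoly k E) (c : ℝ) (x : E) : P (c • x) = c ^ k * P x := by
  obtain ⟨P₁, P₂, ⟨T, _, _, hT⟩, ⟨S, _, _, hS⟩, hP⟩ := P.exists_eq_sub
  have h : ∀ R : ContinuousMultilinearMap ℝ (fun _ : Fin k => E) ℝ,
      (R fun _ => c • x) = c ^ k * R fun _ => x := fun R => by
    simpa using R.map_smul_univ (fun _ => c) (fun _ => x)
  rw [hP, hP, hT, hT, hS, hS, h, h]
  ring

variable [IsOrderedAddMonoid E]

/-- `P ≤ Q` means that the polynomial `Q - P` is positive. -/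
instance : PartialOrder (RegPoly k E) where
  le P Q := IsPosHomPoly k (fun x => Q x - P x)
  le_refl P := by
    convert! IsPosHomPoly.zero (k := k) (E := E) using 1
    funext x; simp
  le_trans P Q R h₁ h₂ := by
    convert! IsPosHomPoly.add h₁ h₂ using 1
    funext x; simp
  le_antisymm P Q h₁ h₂ := by
    ext x
    have a := h₁.nonneg (abs_nonneg x)
    have b := h₂.nonneg (abs_nonneg x)
    have c := h₁.abs_le x
    have d : |Q x - P x| ≤ 0 := by linarith
    have := abs_nonpos_iff.1 d
    linarith

theorem le_iff {P Q : RegPoly k E} : P ≤ Q ↔ IsPosHomPoly k (fun x => Q x - P x) := Iff.rfl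

instance : IsOrderedAddMonoid (RegPoly k E) where
  add_le_add_left P Q h R := by
    rw [le_iff] at h ⊢
    simpa using h

theorem smul_le_smul' {P Q : RegPoly k E} (h : P ≤ Q) {c : ℝ} (hc : 0 ≤ c) : c • P ≤ c • Q := by
  rw [le_iff] at h ⊢
  convert! h.smul hc using 1
  funext x
  simp [mul_sub]

theorem abs_apply_le_of_le {P Q : RegPoly k E} (h₁ : -Q ≤ P) (h₂ : P ≤ Q) (x : E) :
    |P x| ≤ Q |x| := by
  have a := IsPosHomPoly.abs_le (le_iff.1 h₁) x
  have b := IsPosHomPoly.abs_le (le_iff.1 h₂) x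
  simp only [neg_apply, sub_neg_eq_add] at a b
  have e : P x = ((P x + Q x) - (Q x - P x)) / 2 := by ring
  rw [e, abs_div, abs_two, div_le_iff₀ two_pos]
  calc _ ≤ |P x + Q x| + |Q x - P x| := abs_sub _ _
    _ ≤ _ := by linarith

/-- `A` is the absolute value `|P| = P ∨ (-P)` of `P` in the lattice `𝒫ʳ(ᵏE)`. -/
def IsAbs (P A : RegPoly k E) : Prop := IsLUB {P, -P} A

/-- `(P n)` is a disjoint sequence of `𝒫ʳ(ᵏE)`: `|P m| ∧ |P n| = 0` for `m ≠ n`. -/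
def DisjointSeq (P : ℕ → RegPoly k E) : Prop :=
  ∀ m n, m ≠ n → ∃ A B, IsAbs (P m) A ∧ IsAbs (P n) B ∧ IsGLB {A, B} 0

/-- The regular norm `‖P‖ᵣ = inf {‖Q‖ : -Q ≤ P ≤ Q}`; the infimum is attained at `Q = |P|`, see
`RegPoly.norm_eq_of_isAbs`. -/
def regNorm (P : RegPoly k E) : ℝ := sInf {r | ∃ Q : RegPoly k E, -Q ≤ P ∧ P ≤ Q ∧ r = Q.supNorm}

theorem regNorm_nonneg (P : RegPoly k E) : 0 ≤ P.regNorm := by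
  apply Real.sInf_nonneg
  rintro _ ⟨Q, _, _, rfl⟩
  exact Q.supNorm_nonneg

theorem regNorm_le {P Q : RegPoly k E} (h₁ : -Q ≤ P) (h₂ : P ≤ Q) : P.regNorm ≤ Q.supNorm := by
  refine csInf_le ⟨0, ?_⟩ ⟨Q, h₁, h₂, rfl⟩
  rintro _ ⟨Q, _, _, rfl⟩
  exact Q.supNorm_nonneg

theorem exists_dominating (P : RegPoly k E) : ∃ Q : RegPoly k E, -Q ≤ P ∧ P ≤ Q := by
  obtain ⟨P₁, P₂, h₁, h₂, hP⟩ := P.exists_eq_sub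
  refine ⟨ofPos (h₁.add h₂), ?_, ?_⟩
  · rw [le_iff]
    convert! h₁.add h₁ using 1
    funext x
    simp only [neg_apply, ofPos_apply, hP, Pi.add_apply]
    ring
  · rw [le_iff]
    convert! h₂.add h₂ using 1
    funext x
    simp only [ofPos_apply, hP, Pi.add_apply]
    ring

theorem le_regNorm {P : RegPoly k E} {C : ℝ}
    (h : ∀ Q : RegPoly k E, -Q ≤ P → P ≤ Q → C ≤ Q.supNorm) : C ≤ P.regNorm := by
  obtain ⟨Q, h₁, h₂⟩ := P.exists_dominating
  refine le_csInf ⟨_, Q, h₁, h₂, rfl⟩ ?_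
  rintro _ ⟨Q, h₁, h₂, rfl⟩
  exact h Q h₁ h₂

theorem regNorm_add_le (P Q : RegPoly k E) : (P + Q).regNorm ≤ P.regNorm + Q.regNorm := by
  rw [← sub_le_iff_le_add]
  refine le_regNorm fun A a₁ a₂ => ?_
  rw [sub_le_comm]
  refine le_regNorm fun B b₁ b₂ => ?_
  rw [sub_le_iff_le_add']
  refine (regNorm_le (Q := A + B) ?_ (add_le_add a₂ b₂)).trans (supNorm_le fun x hx => ?_)
  · rw [neg_add]
    exact add_le_add a₁ b₁
  · exact (abs_add_le _ _).trans
      (add_le_add (A.abs_apply_le_supNorm hx) (B.abs_apply_le_supNorm hx))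

theorem regNorm_smul_le (c : ℝ) (P : RegPoly k E) : (c • P).regNorm ≤ |c| * P.regNorm := by
  have key : ∀ Q : RegPoly k E, -Q ≤ P → P ≤ Q → (c • P).regNorm ≤ |c| * Q.supNorm := by
    intro Q h₁ h₂
    have h : -(|c| • Q) ≤ c • P ∧ c • P ≤ |c| • Q := by
      rcases le_total 0 c with hc | hc
      · rw [abs_of_nonneg hc, ← smul_neg]
        exact ⟨smul_le_smul' h₁ hc, smul_le_smul' h₂ hc⟩
      · have hc' : 0 ≤ -c := neg_nonneg.2 hc
        rw [abs_of_nonpos hc]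
        have a := smul_le_smul' h₁ hc'
        have b := smul_le_smul' h₂ hc'
        simp only [neg_smul, smul_neg, neg_neg] at a b ⊢
        exact ⟨by simpa using neg_le_neg b, by simpa using neg_le_neg a⟩
    refine (regNorm_le h.1 h.2).trans (supNorm_le fun x hx => ?_)
    rw [smul_apply, abs_mul, abs_abs]
    exact mul_le_mul_of_nonneg_left (Q.abs_apply_le_supNorm hx) (abs_nonneg c)
  rcases eq_or_ne c 0 with rfl | hc
  · obtain ⟨Q, h₁, h₂⟩ := P.exists_dominating
    simpa using key Q h₁ h₂
  · have hc : 0 < |c| := abs_pos.2 hc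
    rw [← div_le_iff₀' hc]
    exact le_regNorm fun Q h₁ h₂ => (div_le_iff₀' hc).2 (key Q h₁ h₂)

theorem regNorm_smul (c : ℝ) (P : RegPoly k E) : (c • P).regNorm = |c| * P.regNorm := by
  refine le_antisymm (regNorm_smul_le c P) ?_
  rcases eq_or_ne c 0 with rfl | hc
  · simpa using regNorm_nonneg _
  · have h := regNorm_smul_le c⁻¹ (c • P)
    rwa [smul_smul, inv_mul_cancel₀ hc, one_smul, abs_inv,
      le_inv_mul_iff₀ (abs_pos.2 hc)] at h

variable [HasSolidNorm E]

theorem abs_apply_le_regNorm (P : RegPoly k E) {x : E} (hx : ‖x‖ ≤ 1) : |P x| ≤ P.regNorm :=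
  le_regNorm fun Q h₁ h₂ => (abs_apply_le_of_le h₁ h₂ x).trans <|
    (le_abs_self _).trans <| Q.abs_apply_le_supNorm (by rwa [norm_abs_eq_norm])

/-- The regular norm. -/
instance : Norm (RegPoly k E) := ⟨regNorm⟩

theorem normCore : NormedSpace.Core ℝ (RegPoly k E) where
  norm_nonneg := regNorm_nonneg
  norm_smul := regNorm_smul
  norm_triangle := regNorm_add_le
  norm_eq_zero_iff P := by
    constructor
    · intro h
      change P.regNorm = 0 at h
      have h0 : ∀ x : E, ‖x‖ ≤ 1 → P x = 0 := fun x hx =>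
        abs_nonpos_iff.1 (h ▸ P.abs_apply_le_regNorm hx)
      ext x
      have hpos : 0 < ‖x‖ + 1 := by positivity
      have hx : x = (‖x‖ + 1) • ((‖x‖ + 1)⁻¹ • x) := by
        rw [smul_smul, mul_inv_cancel₀ hpos.ne', one_smul]
      rw [hx, map_smul_self, h0, mul_zero, zero_apply]
      rw [norm_smul, norm_inv, Real.norm_of_nonneg hpos.le, inv_mul_le_iff₀ hpos]
      linarith
    · rintro rfl
      change (0 : RegPoly k E).regNorm = 0
      simpa using regNorm_smul 0 (0 : RegPoly k E)

instance : NormedAddCommGroup (RegPoly k E) := NormedAddCommGroup.ofCore normCore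

instance : NormedSpace ℝ (RegPoly k E) := NormedSpace.ofCore normCore

/-- The regular norm of `P` is the supremum norm of `|P|`. -/
theorem norm_eq_of_isAbs {P A : RegPoly k E} (h : IsAbs P A) : ‖P‖ = A.supNorm := by
  have h₂ : P ≤ A := h.1 (by simp)
  have h₁ : -P ≤ A := h.1 (by simp)
  have h₁' : -A ≤ P := by simpa using neg_le_neg h₁
  refine le_antisymm (regNorm_le h₁' h₂) (le_regNorm fun Q q₁ q₂ => ?_)
  have hAQ : A ≤ Q := h.2 (by
    rintro R (rfl | rfl)
    · exact q₂
    · simpa using neg_le_neg q₁)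
  have hA : -A ≤ A := h₁'.trans h₂
  refine supNorm_le fun x hx => (abs_apply_le_of_le hA le_rfl x).trans ?_
  have := IsPosHomPoly.nonneg (le_iff.1 hAQ) (abs_nonneg x)
  have hb := (le_abs_self (Q |x|)).trans (Q.abs_apply_le_supNorm (by rwa [norm_abs_eq_norm]))
  linarith

end RegPoly

end Polynomials

end

noncomputable section

/-! ### Bidual limits, weakly null sequences and convex combinations. -/

section FunctionalAnalysis

variable {X : Type*} [NormedAddCommGroup X] [NormedSpace ℝ X]

/-! Two arguments carry the equivalence.

From the disjoint property to polynomials: insert `x n` into a symmetric `k`-linear form one slot at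
a time. The functional left in the last slot must be weakly null, and testing it against a bidual
element `φ` produces a form in one variable fewer, so induction applies. By Goldstine, replacing a
vector of the unit ball by such a `φ` keeps the values inside a fixed closed set on which
convergence is known (`DisjointDPP.tendsto_multilinear`). For weakly compact `P` this set comes from
a weakly compact set containing the associated form's values on unit tuples, on which a subsequence
of norming functionals converges. For sequences in `RegPoly` it comes from a weak-star compact ball
of the dual of `RegPoly`.

From polynomials back to the disjoint property: given disjoint `x n` and weakly null `f n`, let `g
n` be the modulus of `f n` on the band generated by `x n`. The `g n` are positive, pairwise disjoint
and dominate `f n` at `x n`. They are again weakly null, by a gliding hump argument on disjoint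
ideals (`weaklyNull_of_isModulusOn`). Since `|x n|` is still weakly `p`-summable, everything may be
taken positive (`disjointDPP_of_positive`). The powers `g n ^ k` then form a positive disjoint
weakly null sequence in `RegPoly`, and `x ↦ (g n x ^ k)` is a positive weakly compact polynomial
into `c₀`. Testing either on `|x n|` forces `g n |x n| → 0`. -/

theorem bidual_mem_closure_of_finite {ι : Type*} [Finite ι] (g : ι → X →L[ℝ] ℝ)
    {φ : (X →L[ℝ] ℝ) →L[ℝ] ℝ} (hφ : ‖φ‖ ≤ 1) :
    (fun i => φ (g i)) ∈ closure ((fun (y : X) i => g i y) '' Metric.closedBall 0 1) := by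
  classical
  have := Fintype.ofFinite ι
  by_contra hmem
  have hconv : Convex ℝ ((fun (y : X) i => g i y) '' Metric.closedBall 0 1) :=
    (convex_closedBall (0 : X) 1).linear_image (LinearMap.pi fun i => (g i : X →ₗ[ℝ] ℝ))
  obtain ⟨L, u, hL, hu⟩ := geometric_hahn_banach_closed_point hconv.closure isClosed_closure hmem
  -- The separating functional on `ι → ℝ` pulls back to `G`, which has norm at most `u` although `φ
  -- G > u`.
  set G : X →L[ℝ] ℝ := ∑ i, L (Pi.single i 1) • g i with hG
  have hLG : ∀ c : ι → ℝ, L c = ∑ i, L (Pi.single i 1) * c i := fun c => by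
    conv_lhs => rw [← ContinuousLinearMap.coe_coe, LinearMap.pi_apply_eq_sum_univ]
    refine Finset.sum_congr rfl fun i _ => ?_
    rw [smul_eq_mul, mul_comm]
    have e : (fun j => if i = j then (1 : ℝ) else 0) = Pi.single i 1 := by
      ext j
      simp [Pi.single_apply, eq_comm]
    rw [e]
    rfl
  have h1 : ∀ y : X, ‖y‖ ≤ 1 → G y < u := fun y hy => by
    have := hL _ (subset_closure ⟨y, by simpa using hy, rfl⟩)
    rw [hLG] at this
    simpa [hG] using this
  have h2 : u < φ G := by
    rw [hLG] at hu
    simpa [hG] using hu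
  have hu0 : 0 < u := by simpa using h1 0 (by simp)
  have h3 : ‖G‖ ≤ u := by
    refine ContinuousLinearMap.opNorm_le_of_unit_norm hu0.le fun y hy => ?_
    rw [Real.norm_eq_abs, abs_le]
    have := h1 (-y) (by simp [hy])
    rw [map_neg] at this
    exact ⟨by linarith, (h1 y hy.le).le⟩
  have h4 := (le_abs_self _).trans (φ.le_of_opNorm_le hφ G)
  linarith

/-- Goldstine's theorem, tested against an arbitrary family of functionals. -/
theorem bidual_mem_closure {ι : Type*} (g : ι → X →L[ℝ] ℝ)
    {φ : (X →L[ℝ] ℝ) →L[ℝ] ℝ} (hφ : ‖φ‖ ≤ 1) :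
    (fun i => φ (g i)) ∈ closure ((fun (y : X) i => g i y) '' Metric.closedBall 0 1) := by
  rw [mem_closure_iff]
  intro o ho hmem
  obtain ⟨I, u, hu, hsub⟩ := isOpen_pi_iff.1 ho _ hmem
  have h := bidual_mem_closure_of_finite (fun i : I => g i) hφ
  rw [mem_closure_iff] at h
  obtain ⟨_, hc, y, hy, rfl⟩ := h (Set.univ.pi fun i : I => u i)
    (isOpen_set_pi Set.finite_univ fun i _ => (hu i i.2).1) (fun i _ => (hu i i.2).2)
  exact ⟨_, hsub fun i hi => hc ⟨i, hi⟩ trivial, y, hy, rfl⟩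

/-- Goldstine in the form used later: inequalities between values at vectors of the ball pass to `φ`
along a single ultrafilter. -/
theorem exists_ultrafilter_tendsto_bidual {φ : (X →L[ℝ] ℝ) →L[ℝ] ℝ} (hφ : ‖φ‖ ≤ 1) :
    ∃ U : Ultrafilter X, (∀ᶠ y in (U : Filter X), ‖y‖ ≤ 1) ∧
      ∀ f : X →L[ℝ] ℝ, Tendsto f U (𝓝 (φ f)) := by
  have h := bidual_mem_closure (fun f : X →L[ℝ] ℝ => f) hφ
  have hne : (comap (fun (y : X) (f : X →L[ℝ] ℝ) => f y) (𝓝 fun f => φ f) ⊓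
      𝓟 (Metric.closedBall (0 : X) 1)).NeBot := by
    rw [mem_closure_iff_nhds] at h
    rw [inf_principal_neBot_iff]
    rintro V ⟨W, hW, hWV⟩
    obtain ⟨_, hc, y, hy, rfl⟩ := h W hW
    exact ⟨y, hWV hc, hy⟩
  obtain ⟨U, hU⟩ := @Ultrafilter.exists_le _ _ hne
  refine ⟨U, ?_, fun f => ?_⟩
  · filter_upwards [(hU.trans inf_le_right) (mem_principal_self _)] with y hy
    simpa using hy
  · have := tendsto_iff_comap.2 (hU.trans inf_le_left)
    exact (tendsto_pi_nhds.1 this) f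

/-- Bounded sequences of vectors converge along ultrafilters to elements of the bidual. -/
theorem exists_bidual_limit {Y : Type*} (U : Ultrafilter Y) (z : Y → X) {C : ℝ}
    (hz : ∀ᶠ y in (U : Filter Y), ‖z y‖ ≤ C) :
    ∃ ψ : (X →L[ℝ] ℝ) →L[ℝ] ℝ, ∀ f : X →L[ℝ] ℝ, Tendsto (fun y => f (z y)) U (𝓝 (ψ f)) := by
  have hc := WeakDual.isCompact_closedBall (𝕜 := ℝ) (E := X →L[ℝ] ℝ) 0 C
  obtain ⟨ψ, _, hψ⟩ := hc.ultrafilter_le_nhds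
    (U.map fun y => StrongDual.toWeakDual (NormedSpace.inclusionInDoubleDual ℝ X (z y))) (by
      rw [Ultrafilter.coe_map, le_principal_iff, mem_map]
      filter_upwards [hz] with y hy
      simpa using (NormedSpace.double_dual_bound ℝ X (z y)).trans hy)
  refine ⟨WeakDual.toStrongDual ψ, fun f => ?_⟩
  have := ((WeakDual.eval_continuous f).tendsto ψ).comp
    (show Tendsto _ (U : Filter Y) (𝓝 ψ) from hψ)
  exact this

theorem WeaklyNull.comp_strictMono {v : ℕ → X} (hv : WeaklyNull v) {s : ℕ → ℕ}
    (hs : StrictMono s) : WeaklyNull (v ∘ s) :=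
  fun φ => (hv φ).comp hs.tendsto_atTop

theorem weaklyNull_of_unit_ball {v : ℕ → X}
    (h : ∀ φ : X →L[ℝ] ℝ, ‖φ‖ ≤ 1 → Tendsto (fun n => φ (v n)) atTop (𝓝 0)) : WeaklyNull v := by
  intro φ
  have hpos : 0 < ‖φ‖ + 1 := by positivity
  have := (h ((‖φ‖ + 1)⁻¹ • φ) (by
    rw [norm_smul, norm_inv, Real.norm_of_nonneg hpos.le, inv_mul_le_iff₀ hpos]
    linarith)).const_mul (‖φ‖ + 1)
  simpa [mul_inv_cancel_left₀ hpos.ne'] using this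

theorem WeaklyNull.exists_bound [CompleteSpace X] {f : ℕ → X →L[ℝ] ℝ} (hf : WeaklyNull f) :
    ∃ M, 0 < M ∧ ∀ n, ‖f n‖ ≤ M := by
  obtain ⟨C, hC⟩ := banach_steinhaus (g := f) fun x => by
    have h := hf (NormedSpace.inclusionInDoubleDual ℝ X x)
    obtain ⟨C, hC⟩ := h.norm.bddAbove_range
    exact ⟨C, fun n => by simpa using hC ⟨n, rfl⟩⟩
  exact ⟨|C| + 1, by positivity, fun n => (hC n).trans ((le_abs_self C).trans (by linarith))⟩

/-- Mazur: a weakly null sequence has norm small finite convex combinations. -/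
theorem exists_convex_combination_norm_lt {v : ℕ → X} (hv : WeaklyNull v) {δ : ℝ} (hδ : 0 < δ) :
    ∃ (s : Finset ℕ) (a : ℕ → ℝ), (∀ i ∈ s, 0 ≤ a i) ∧ ∑ i ∈ s, a i = 1 ∧
      ‖∑ i ∈ s, a i • v i‖ < δ := by
  have h0 : (0 : X) ∈ closure (convexHull ℝ (Set.range v)) := by
    by_contra h
    obtain ⟨L, u, hu, hL⟩ := geometric_hahn_banach_point_closed
      (convex_convexHull ℝ (Set.range v)).closure isClosed_closure h
    rw [map_zero] at hu
    have hge : ∀ n, u ≤ L (v n) := fun n =>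
      (hL _ (subset_closure (subset_convexHull _ _ ⟨n, rfl⟩))).le
    have := ge_of_tendsto' (hv L) hge
    linarith
  obtain ⟨w, hw, hwδ⟩ := Metric.mem_closure_iff.1 h0 δ hδ
  rw [dist_zero_left] at hwδ
  rw [convexHull_range_eq_exists_affineCombination] at hw
  obtain ⟨s, a, ha, ha1, rfl⟩ := hw
  refine ⟨s, a, ha, ha1, ?_⟩
  rwa [Finset.affineCombination_eq_linear_combination _ _ _ ha1] at hwδ

end FunctionalAnalysis

/-! ### Gliding hump, and subsequences converging on weakly compact sets. -/

section Extraction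

variable {X : Type*} [NormedAddCommGroup X] [NormedSpace ℝ X]

/-- The uniform bound on partial sums of absolute values makes every subseries converge pointwise to
a bounded functional; these are the test functionals of the gliding hump. -/
theorem exists_subseries_functional {ψ : ℕ → X →L[ℝ] ℝ} {C : ℝ}
    (hψ : ∀ N f, ∑ m ∈ Finset.range N, |ψ m f| ≤ C * ‖f‖) (A : Set ℕ) :
    ∃ Ψ : X →L[ℝ] ℝ, ∀ f, HasSum (A.indicator fun m => ψ m f) (Ψ f) := by
  have hs : ∀ f, Summable fun m => |ψ m f| := fun f =>
    summable_of_sum_range_le (fun _ => abs_nonneg _) fun N => hψ N f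
  have hsA : ∀ f, Summable (A.indicator fun m => ψ m f) := fun f => (hs f).of_abs.indicator A
  refine ⟨LinearMap.mkContinuous
    { toFun := fun f => ∑' m, A.indicator (fun m => ψ m f) m
      map_add' := fun f g => ?_
      map_smul' := fun c f => ?_ } C fun f => ?_, fun f => (hsA f).hasSum⟩
  · rw [← (hsA f).tsum_add (hsA g)]
    congr 1
    funext m
    by_cases hm : m ∈ A <;> simp [hm]
  · simp only [RingHom.id_apply, smul_eq_mul]
    rw [← tsum_mul_left]
    congr 1
    funext m
    by_cases hm : m ∈ A <;> simp [hm]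
  · refine le_of_tendsto ((hsA f).hasSum.tendsto_sum_nat.norm) (.of_forall fun N => ?_)
    refine (norm_sum_le _ _).trans ((Finset.sum_le_sum fun m _ => ?_).trans (hψ N f))
    exact norm_indicator_le_norm_self (fun m => ψ m f) m

/-- The diagonal form of the Schur property of `ℓ¹`. -/
theorem tendsto_diagonal_of_weaklyNull {ψ : ℕ → X →L[ℝ] ℝ} {C : ℝ}
    (hψ : ∀ N f, ∑ m ∈ Finset.range N, |ψ m f| ≤ C * ‖f‖) {v : ℕ → X} (hv : WeaklyNull v) :
    Tendsto (fun n => ψ n (v n)) atTop (𝓝 0) := by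
  by_contra hcon
  obtain ⟨ε, hε, hfreq⟩ : ∃ ε > 0, ∃ᶠ n in atTop, ε ≤ |ψ n (v n)| := by
    simp only [Metric.tendsto_nhds, not_forall, exists_prop] at hcon
    obtain ⟨ε, hε, h⟩ := hcon
    exact ⟨ε, hε, (not_eventually.1 h).mono fun n hn => by simpa using hn⟩
  have hs : ∀ f, Summable fun m => |ψ m f| := fun f =>
    summable_of_sum_range_le (fun _ => abs_nonneg _) fun N => hψ N f
  -- The hump: earlier `ψ m` are already small on `v n'`, and the `ψ m` from `n'` on are small on `v
  -- n`.
  have hstep : ∀ n, ∃ n', n < n' ∧ ε ≤ |ψ n' (v n')| ∧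
      ∑ m ∈ Finset.range (n + 1), |ψ m (v n')| ≤ ε / 4 ∧
      ∀ N, ∑ m ∈ Finset.Ico n' N, |ψ m (v n)| ≤ ε / 4 := by
    intro n
    have h1 : ∀ᶠ n' in atTop, ∑ m ∈ Finset.range (n + 1), |ψ m (v n')| ≤ ε / 4 := by
      have : Tendsto (fun n' => ∑ m ∈ Finset.range (n + 1), |ψ m (v n')|) atTop (𝓝 0) := by
        simpa using tendsto_finsetSum (Finset.range (n + 1)) fun m _ => (hv (ψ m)).abs
      exact this.eventually_le_const (by positivity)
    have h2 : ∀ᶠ n' in atTop, ∀ N, ∑ m ∈ Finset.Ico n' N, |ψ m (v n)| ≤ ε / 4 := by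
      have ht := (hs (v n)).hasSum.tendsto_sum_nat
      filter_upwards [ht.eventually_const_le (u := (∑' m, |ψ m (v n)|) - ε / 4) (by linarith)]
        with n' hn' N
      rcases le_total n' N with h | h
      · rw [Finset.sum_Ico_eq_sub _ h]
        have := (hs (v n)).sum_le_tsum (Finset.range N) fun _ _ => abs_nonneg _
        linarith
      · rw [Finset.Ico_eq_empty_of_le h, Finset.sum_empty]
        positivity
    obtain ⟨n', ha, ⟨hb, hc⟩, hd⟩ :=
      (hfreq.and_eventually ((h1.and h2).and (eventually_gt_atTop n))).exists
    exact ⟨n', hd, ha, hb, hc⟩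
  choose next hlt hbad hhead htail using hstep
  set s : ℕ → ℕ := fun i => next^[i] 0
  have hsucc : ∀ i, s (i + 1) = next (s i) := fun i => Function.iterate_succ_apply' _ _ _
  have hmono : StrictMono s := strictMono_nat_of_lt_succ fun i => by rw [hsucc]; exact hlt _
  obtain ⟨Ψ, hΨ⟩ := exists_subseries_functional hψ (Set.range s)
  have hlow : ∀ j, ε / 2 ≤ |Ψ (v (s (j + 1)))| := by
    intro j
    set w := v (s (j + 1)) with hw
    have hmem : s (j + 1) ∈ Set.range s := ⟨_, rfl⟩
    -- Deleting the main term from the series of `Ψ w` leaves only indices in the head or the tail,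
    -- so at most `ε / 4 + ε / 4`.
    have hdiff := (hΨ w).update (s (j + 1)) 0
    rw [Set.indicator_of_mem hmem] at hdiff
    have hle : |0 - ψ (s (j + 1)) w + Ψ w| ≤ ε / 2 := by
      refine le_of_tendsto hdiff.tendsto_sum_nat.abs (.of_forall fun N => ?_)
      refine (Finset.abs_sum_le_sum_abs _ _).trans ?_
      calc _ ≤ ∑ m ∈ Finset.range (s j + 1) ∪ Finset.Ico (s (j + 2)) N, |ψ m w| := by
            rw [← Finset.sum_filter_add_sum_filter_not (Finset.range N)
              (· ∈ Finset.range (s j + 1) ∪ Finset.Ico (s (j + 2)) N)]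
            have hzero : ∀ m ∈ Finset.range N,
                m ∉ Finset.range (s j + 1) ∪ Finset.Ico (s (j + 2)) N →
                |Function.update ((Set.range s).indicator fun m => ψ m w) (s (j + 1)) 0 m| = 0 := by
              intro m hmN hm
              rw [abs_eq_zero, Function.update_apply]
              split_ifs with hms
              · rfl
              refine Set.indicator_of_notMem ?_ _
              rintro ⟨i, rfl⟩
              simp only [Finset.mem_union, Finset.mem_range, Finset.mem_Ico, not_or, not_and_or,
                not_lt, not_le] at hm hmN
              have h1 : j < i := hmono.lt_iff_lt.1 (Nat.lt_of_succ_le hm.1)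
              have h2 : i < j + 2 := hmono.lt_iff_lt.1 (by omega)
              exact hms (congrArg s (by omega))
            rw [Finset.sum_eq_zero (s := Finset.filter _ _) fun m hm =>
              hzero m (Finset.mem_filter.1 hm).1 (Finset.mem_filter.1 hm).2, add_zero]
            refine (Finset.sum_le_sum fun m hm => ?_).trans
              (Finset.sum_le_sum_of_subset_of_nonneg (fun m hm => (Finset.mem_filter.1 hm).2)
                fun _ _ _ => abs_nonneg _)
            rw [Function.update_apply]
            split_ifs
            · simp
            · exact norm_indicator_le_norm_self (fun m => ψ m w) m
        _ ≤ ∑ m ∈ Finset.range (s j + 1), |ψ m w| + ∑ m ∈ Finset.Ico (s (j + 2)) N, |ψ m w| := by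
            rw [← Finset.sum_union_inter]
            exact le_add_of_nonneg_right (Finset.sum_nonneg fun _ _ => abs_nonneg _)
        _ ≤ ε / 4 + ε / 4 := by
            refine add_le_add ?_ ?_
            · rw [hw, hsucc]; exact hhead _
            · rw [hsucc (j + 1)]; exact htail _ _
        _ = ε / 2 := by ring
    have h3 : ε ≤ |ψ (s (j + 1)) w| := by rw [hw, hsucc]; exact hbad _
    have h4 := abs_sub_abs_le_abs_sub (ψ (s (j + 1)) w) (Ψ w)
    rw [abs_sub_comm] at h4
    have h5 : 0 - ψ (s (j + 1)) w + Ψ w = Ψ w - ψ (s (j + 1)) w := by ring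
    rw [h5] at hle
    linarith
  have ht := ((hv Ψ).comp (hmono.tendsto_atTop.comp (tendsto_add_atTop_nat 1))).abs
  have := ge_of_tendsto' ht hlow
  simp at this
  linarith

/-- A bounded sequence of functionals has a subsequence that converges on a given weakly compact
set to a functional. -/
theorem exists_subseq_tendsto_on_weaklyCompact {K : Set (WeakSpace ℝ X)} (hK : IsCompact K)
    (f : ℕ → X →L[ℝ] ℝ) {M : ℝ} (hf : ∀ n, ‖f n‖ ≤ M) :
    ∃ (s : ℕ → ℕ) (g : X →L[ℝ] ℝ), StrictMono s ∧ ∀ z : X, toWeakSpace ℝ X z ∈ K →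
      Tendsto (fun j => f (s j) z) atTop (𝓝 (g z)) := by
  have hcont : ∀ h : X →L[ℝ] ℝ, Continuous fun z : WeakSpace ℝ X => h ((toWeakSpace ℝ X).symm z) :=
    fun h => WeakBilin.eval_continuous _ h
  -- `K` itself may be nonseparable, but its image in `ℕ → ℝ` is separable; a diagonal subsequence
  -- converges at lifts of a countable dense set.
  let G : WeakSpace ℝ X → ℕ → ℝ := fun z n => f n ((toWeakSpace ℝ X).symm z)
  have hG : Continuous G := continuous_pi fun n => hcont (f n)
  obtain ⟨D, hDG, hDc, hDd⟩ :=
    (TopologicalSpace.IsSeparable.of_separableSpace (G '' K)).exists_countable_dense_subset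
  have hlift : ∀ d : D, ∃ z ∈ K, G z = d := fun d => hDG d.2
  choose e heK heG using hlift
  have : Countable D := hDc
  obtain ⟨a, -, s, hs, ha⟩ := (isCompact_univ_pi fun d : D =>
      isCompact_Icc (a := -(M * ‖(toWeakSpace ℝ X).symm (e d)‖))
        (b := M * ‖(toWeakSpace ℝ X).symm (e d)‖)).tendsto_subseq
    (x := fun n (d : D) => f n ((toWeakSpace ℝ X).symm (e d)))
    (fun n d _ => abs_le.1 ((f n).le_of_opNorm_le (hf n) _))
  have ha' : ∀ d : D, Tendsto (fun j => f (s j) ((toWeakSpace ℝ X).symm (e d))) atTop (𝓝 (a d)) :=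
    fun d => (tendsto_pi_nhds.1 ha) d
  have hlim : ∀ U : Ultrafilter ℕ, ∃ g : X →L[ℝ] ℝ,
      ∀ z, Tendsto (fun j => f (s j) z) U (𝓝 (g z)) := by
    intro U
    obtain ⟨ψ, _, hψ⟩ := (WeakDual.isCompact_closedBall (𝕜 := ℝ) (E := X) 0 M).ultrafilter_le_nhds
      (U.map fun j => StrongDual.toWeakDual (f (s j))) (by
        rw [Ultrafilter.coe_map, le_principal_iff, mem_map]
        exact Filter.univ_mem' fun j => by simpa using hf (s j))
    exact ⟨WeakDual.toStrongDual ψ, fun z => ((WeakDual.eval_continuous z).tendsto ψ).comp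
      (show Tendsto _ (U : Filter ℕ) (𝓝 ψ) from hψ)⟩
  -- Two weak-star cluster points agree at the lifts. Lifts approximating `G z` cluster weakly at
  -- some `t` in `K` which no `f n` distinguishes from `z`, so agreement at `t`, by weak continuity,
  -- gives agreement at `z`.
  have huniq : ∀ (U V : Ultrafilter ℕ), (U : Filter ℕ) ≤ atTop → (V : Filter ℕ) ≤ atTop →
      ∀ g h : X →L[ℝ] ℝ, (∀ z, Tendsto (fun j => f (s j) z) U (𝓝 (g z))) →
        (∀ z, Tendsto (fun j => f (s j) z) V (𝓝 (h z))) →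
        ∀ z, toWeakSpace ℝ X z ∈ K → g z = h z := by
    intro U V hU hV g h hg hh z hz
    have hzD : G (toWeakSpace ℝ X z) ∈ closure D := hDd ⟨_, hz, rfl⟩
    obtain ⟨d, hd, hdlim⟩ := mem_closure_iff_seq_limit.1 hzD
    obtain ⟨t, htK, ht⟩ := hK.ultrafilter_le_nhds
      ((Filter.hyperfilter ℕ).map fun i => e ⟨d i, hd i⟩) (by
        rw [Ultrafilter.coe_map, le_principal_iff, mem_map]
        exact Filter.univ_mem' fun i => heK _)
    have ht' : Tendsto (fun i => e ⟨d i, hd i⟩) (Filter.hyperfilter ℕ) (𝓝 t) := ht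
    have hGt : G t = G (toWeakSpace ℝ X z) := by
      refine tendsto_nhds_unique ((hG.tendsto t).comp ht') ?_
      have := hdlim.mono_left Nat.hyperfilter_le_atTop
      exact this.congr fun i => (heG ⟨d i, hd i⟩).symm
    have hft : ∀ n, f n ((toWeakSpace ℝ X).symm t) = f n z := fun n => congrFun hGt n
    have hgt : g ((toWeakSpace ℝ X).symm t) = g z :=
      tendsto_nhds_unique (hg _) (by simpa only [hft] using hg z)
    have hht : h ((toWeakSpace ℝ X).symm t) = h z :=
      tendsto_nhds_unique (hh _) (by simpa only [hft] using hh z)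
    rw [← hgt, ← hht]
    refine tendsto_nhds_unique (((hcont g).tendsto t).comp ht') ?_
    refine (((hcont h).tendsto t).comp ht').congr fun i => ?_
    have e₁ := tendsto_nhds_unique (hh _) ((ha' ⟨d i, hd i⟩).mono_left hV)
    have e₂ := tendsto_nhds_unique (hg _) ((ha' ⟨d i, hd i⟩).mono_left hU)
    exact e₁.trans e₂.symm
  obtain ⟨g, hg⟩ := hlim (Filter.hyperfilter ℕ)
  refine ⟨s, g, hs, fun z hz => ?_⟩
  rw [tendsto_iff_ultrafilter]
  intro U hU
  obtain ⟨h, hh⟩ := hlim U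
  rw [huniq _ U Nat.hyperfilter_le_atTop hU g h hg hh z hz]
  exact hh z

end Extraction

/-! ### Riesz decomposition, disjoint sums and bands. -/

section LatticeGroup

variable {E : Type*} [AddCommGroup E] [Lattice E]

/-- An order ideal, as a solid set closed under addition. -/
structure IsOrderIdeal (I : Set E) : Prop where
  zero_mem : 0 ∈ I
  add_mem : ∀ {x y}, x ∈ I → y ∈ I → x + y ∈ I
  solid : ∀ {x y}, y ∈ I → |x| ≤ |y| → x ∈ I

theorem IsOrderIdeal.neg_mem {I : Set E} (hI : IsOrderIdeal I) {x : E} (hx : x ∈ I) : -x ∈ I :=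
  hI.solid hx (abs_neg x).le

/-- The double disjoint complement of `S`. -/
def bandOf (S : Set E) : Set E :=
  {z | ∀ w, (∀ s ∈ S, |w| ⊓ |s| = 0) → |z| ⊓ |w| = 0}

theorem subset_bandOf (S : Set E) : S ⊆ bandOf S := fun s hs w hw => by
  rw [inf_comm]
  exact hw s hs

variable [IsOrderedAddMonoid E]

theorem abs_le_iff_neg_le_and_le {a b : E} : |a| ≤ b ↔ -b ≤ a ∧ a ≤ b := by
  rw [abs_le', and_comm, neg_le]

theorem add_inf_le_inf_add_inf {a b c : E} (ha : 0 ≤ a) (hb : 0 ≤ b) (hc : 0 ≤ c) :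
    (a + b) ⊓ c ≤ a ⊓ c + b ⊓ c := by
  rw [add_inf, inf_add, inf_add]
  refine le_inf (le_inf inf_le_left ?_) (le_inf ?_ ?_)
  · exact inf_le_right.trans (le_add_of_nonneg_right hb)
  · exact inf_le_right.trans (le_add_of_nonneg_left ha)
  · exact inf_le_right.trans (le_add_of_nonneg_left hc)

/-- Take for `z₁` the truncation of `z` to `[-a, a]`. The bounds by `|z|` keep both pieces in any
order ideal containing `z`. -/
theorem riesz_decomposition {z a b : E} (ha : 0 ≤ a) (hb : 0 ≤ b) (hz : |z| ≤ a + b) :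
    ∃ z₁ z₂, z₁ + z₂ = z ∧ |z₁| ≤ a ∧ |z₂| ≤ b ∧ |z₁| ≤ |z| ∧ |z₂| ≤ |z| := by
  obtain ⟨hz₁, hz₂⟩ := abs_le_iff_neg_le_and_le.1 hz
  have hn := abs_nonneg z
  have key : ∀ c : E, 0 ≤ c → z ≤ a + c → -(a + c) ≤ z → |z - z ⊓ a ⊔ -a| ≤ c := by
    intro c hc h₁ h₂
    refine abs_le_iff_neg_le_and_le.2 ⟨?_, ?_⟩
    · rw [neg_le_sub_iff_le_add]
      refine sup_le (inf_le_left.trans (le_add_of_nonneg_right hc)) ?_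
      rw [neg_add] at h₂
      exact sub_le_iff_le_add.1 (by rwa [sub_eq_add_neg])
    · rw [sub_le_iff_le_add', ← sub_le_iff_le_add]
      exact (le_inf (sub_le_self _ hc) (sub_le_iff_le_add.2 h₁)).trans le_sup_left
  refine ⟨z ⊓ a ⊔ -a, z - z ⊓ a ⊔ -a, by abel, abs_le_iff_neg_le_and_le.2 ⟨le_sup_right, ?_⟩,
    key b hb hz₂ hz₁,
    abs_le_iff_neg_le_and_le.2 ⟨?_, ?_⟩,
    key _ hn ((le_abs_self z).trans (le_add_of_nonneg_left ha)) ?_⟩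
  · exact sup_le inf_le_right ((neg_nonpos.2 ha).trans ha)
  · exact (le_inf ((abs_le_iff_neg_le_and_le.1 le_rfl).1) ((neg_nonpos.2 hn).trans ha)).trans
      le_sup_left
  · exact sup_le (inf_le_left.trans (le_abs_self z)) ((neg_nonpos.2 ha).trans hn)
  · exact (neg_le_neg (le_add_of_nonneg_left ha)).trans ((abs_le_iff_neg_le_and_le.1 le_rfl).1)

/-- A sum of disjoint positive elements is their supremum, since `a + b = a ⊓ b + a ⊔ b`. -/
theorem sum_abs_le_of_disjoint {ι : Type*} (s : Finset ι) {z : ι → E} {u : E} (hu : 0 ≤ u)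
    (hz : ∀ i ∈ s, |z i| ≤ u) (hd : ∀ i ∈ s, ∀ j ∈ s, i ≠ j → |z i| ⊓ |z j| = 0) :
    ∑ i ∈ s, |z i| ≤ u := by
  classical
  induction s using Finset.induction_on with
  | empty => simpa using hu
  | insert a s ha ih =>
    have hinf : ∀ t ⊆ s, (∑ i ∈ t, |z i|) ⊓ |z a| = 0 := by
      intro t
      induction t using Finset.induction_on with
      | empty => intro _; simp
      | insert b t hb iht =>
        intro hbt
        rw [Finset.sum_insert hb]
        have hnn : 0 ≤ ∑ i ∈ t, |z i| := Finset.sum_nonneg fun _ _ => abs_nonneg _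
        have hbs : b ∈ s := hbt (Finset.mem_insert_self _ _)
        refine le_antisymm ((add_inf_le_inf_add_inf (abs_nonneg _) hnn (abs_nonneg _)).trans ?_)
          (le_inf (add_nonneg (abs_nonneg _) hnn) (abs_nonneg _))
        rw [iht fun i hi => hbt (Finset.mem_insert_of_mem hi),
          hd b (Finset.mem_insert_of_mem hbs) a (Finset.mem_insert_self _ _)
            (fun h => ha (h ▸ hbs)), add_zero]
    rw [Finset.sum_insert ha, ← inf_add_sup, inf_comm, hinf s subset_rfl, zero_add]
    exact sup_le (hz a (Finset.mem_insert_self _ _))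
      (ih (fun i hi => hz i (Finset.mem_insert_of_mem hi)) fun i hi j hj =>
        hd i (Finset.mem_insert_of_mem hi) j (Finset.mem_insert_of_mem hj))

theorem isOrderIdeal_bandOf (S : Set E) : IsOrderIdeal (bandOf S) where
  zero_mem w _ := by simp
  add_mem {x y} hx hy w hw := by
    refine le_antisymm ?_ (le_inf (abs_nonneg _) (abs_nonneg _))
    refine (inf_le_inf_right _ (abs_add_le x y)).trans
      ((add_inf_le_inf_add_inf (abs_nonneg _) (abs_nonneg _) (abs_nonneg _)).trans ?_)
    rw [hx w hw, hy w hw, add_zero]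
  solid {x y} hy hxy w hw :=
    le_antisymm ((inf_le_inf_right _ hxy).trans (hy w hw).le)
      (le_inf (abs_nonneg _) (abs_nonneg _))

theorem eq_zero_of_mem_bandOf {S : Set E} {w z : E} (hz : z ∈ bandOf S)
    (hw : ∀ s ∈ S, |w| ⊓ |s| = 0) (hzw : |z| ≤ |w|) : z = 0 := by
  have := hz w hw
  rw [inf_eq_left.2 hzw] at this
  obtain ⟨h₁, h₂⟩ := abs_le_iff_neg_le_and_le.1 this.le
  exact le_antisymm h₂ (by simpa using h₁)

theorem eq_zero_of_mem_bandOf_of_mem_bandOf {a b z : E} (hab : |a| ⊓ |b| = 0)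
    (ha : z ∈ bandOf {a}) (hb : z ∈ bandOf {b}) : z = 0 := by
  have h := ha b (by simpa [inf_comm] using hab)
  exact eq_zero_of_mem_bandOf hb (w := z) (by simpa using h) le_rfl

end LatticeGroup

/-! ### Stability of disjoint and weakly `p`-summable sequences. -/

section Sequences

variable {E : Type*}

theorem DisjointSeq.abs [AddCommGroup E] [Lattice E] [IsOrderedAddMonoid E] {x : ℕ → E}
    (hx : DisjointSeq x) : DisjointSeq fun n => |x n| :=
  fun m n hmn => by simpa using hx m n hmn

theorem DisjointSeq.comp_injective [AddCommGroup E] [Lattice E] {x : ℕ → E} (hx : DisjointSeq x)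
    {s : ℕ → ℕ} (hs : Function.Injective s) : DisjointSeq (x ∘ s) :=
  fun _ _ hmn => hx _ _ (hs.ne hmn)

variable [NormedAddCommGroup E] [NormedSpace ℝ E]

theorem WeaklyPSummable.comp_injective {p : ℝ} {x : ℕ → E} (hx : WeaklyPSummable p x) {s : ℕ → ℕ}
    (hs : Function.Injective s) : WeaklyPSummable p (x ∘ s) :=
  fun f => (hx f).comp_injective hs

theorem WeaklyPSummable.tendsto {p : ℝ} (hp : 0 < p) {x : ℕ → E} (hx : WeaklyPSummable p x)
    (f : E →L[ℝ] ℝ) : Tendsto (fun n => f (x n)) atTop (𝓝 0) := by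
  have h := ((hx f).tendsto_atTop_zero).rpow_const (p := p⁻¹) (Or.inr (by positivity))
  rw [Real.zero_rpow (inv_ne_zero hp.ne')] at h
  rw [tendsto_zero_iff_abs_tendsto_zero]
  exact h.congr fun n => Real.rpow_rpow_inv (abs_nonneg _) hp.ne'

end Sequences

/-! ### Moduli of functionals on ideals, and passage to positive data. -/

section Modulus

variable {E : Type*} [NormedAddCommGroup E] [NormedSpace ℝ E] [Lattice E]

/-- `g` is the modulus of the part of `f` that lives on the order ideal `I`. -/
def IsModulusOn (I : Set E) (f g : E →L[ℝ] ℝ) : Prop :=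
  ∀ y, 0 ≤ y → IsLUB (f '' {z | z ∈ I ∧ |z| ≤ y}) (g y)

theorem IsModulusOn.exists_lt {I : Set E} {f g : E →L[ℝ] ℝ} (h : IsModulusOn I f g)
    {y : E} (hy : 0 ≤ y) {δ : ℝ} (hδ : 0 < δ) :
    ∃ z ∈ I, |z| ≤ y ∧ g y - δ < f z := by
  obtain ⟨_, ⟨z, ⟨hz, hzy⟩, rfl⟩, hlt, -⟩ := (h y hy).exists_between (sub_lt_self _ hδ)
  exact ⟨z, hz, hzy, hlt⟩

variable [IsOrderedAddMonoid E]

theorem abs_apply_le_apply_abs {g : E →L[ℝ] ℝ} (hg : ∀ y, 0 ≤ y → 0 ≤ g y) (y : E) :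
    |g y| ≤ g |y| := by
  have h₁ := hg _ (sub_nonneg.2 (le_abs_self y))
  have h₂ := hg _ (sub_nonneg.2 (abs_le_iff_neg_le_and_le.1 (le_refl |y|)).1)
  rw [map_sub] at h₁ h₂
  rw [map_neg] at h₂
  exact abs_le.2 ⟨by linarith, by linarith⟩

theorem apply_le_apply_of_le {g : E →L[ℝ] ℝ} (hg : ∀ y, 0 ≤ y → 0 ≤ g y) {a b : E} (h : a ≤ b) :
    g a ≤ g b := by
  have := hg _ (sub_nonneg.2 h)
  rw [map_sub] at this
  linarith

/-- Additive functions on the positive cone extend to linear functionals. -/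
theorem exists_continuousLinearMap_of_additive_on_cone [HasSolidNorm E] {q : E → ℝ} {C : ℝ}
    (hadd : ∀ a b, 0 ≤ a → 0 ≤ b → q (a + b) = q a + q b)
    (hnonneg : ∀ a, 0 ≤ a → 0 ≤ q a) (hle : ∀ a, 0 ≤ a → q a ≤ C * ‖a‖) :
    ∃ g : E →L[ℝ] ℝ, ∀ a, 0 ≤ a → g a = q a := by
  have h0 : q 0 = 0 := by simpa using hadd 0 0 le_rfl le_rfl
  let L : E →+ ℝ :=
    { toFun := fun y => q y⁺ - q y⁻
      map_zero' := by simp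
      map_add' := fun x y => by
        have e : (x + y)⁺ + (x⁻ + y⁻) = x⁺ + y⁺ + (x + y)⁻ := by
          have h₁ := posPart_sub_negPart (x + y)
          have h₂ := posPart_sub_negPart x
          have h₃ := posPart_sub_negPart y
          rw [← sub_eq_zero]
          calc (x + y)⁺ + (x⁻ + y⁻) - (x⁺ + y⁺ + (x + y)⁻)
              = ((x + y)⁺ - (x + y)⁻) - (x⁺ - x⁻) - (y⁺ - y⁻) := by abel
            _ = 0 := by rw [h₁, h₂, h₃]; abel
        have e' := congrArg q e
        rw [hadd _ _ (posPart_nonneg _) (add_nonneg (negPart_nonneg _) (negPart_nonneg _)),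
          hadd _ _ (negPart_nonneg _) (negPart_nonneg _),
          hadd _ _ (add_nonneg (posPart_nonneg _) (posPart_nonneg _)) (negPart_nonneg _),
          hadd _ _ (posPart_nonneg _) (posPart_nonneg _)] at e'
        linarith }
  have hL : ∀ y, ‖L y‖ ≤ C * ‖y‖ := by
    intro y
    have h₁ := hnonneg _ (posPart_nonneg y)
    have h₂ := hnonneg _ (negPart_nonneg y)
    have h₃ := hle _ (abs_nonneg y)
    rw [norm_abs_eq_norm, ← posPart_add_negPart y,
      hadd _ _ (posPart_nonneg y) (negPart_nonneg y)] at h₃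
    change |q y⁺ - q y⁻| ≤ _
    exact abs_le.2 ⟨by linarith, by linarith⟩
  -- Homogeneity comes for free: a continuous additive map is real-linear.
  refine ⟨L.toRealLinearMap (AddMonoidHomClass.continuous_of_bound L C hL), fun a ha => ?_⟩
  change q a⁺ - q a⁻ = q a
  rw [posPart_of_nonneg ha, negPart_of_nonneg ha, h0, sub_zero]

/-- Riesz–Kantorovich: the supremum is additive in `y` by Riesz decomposition, whose pieces stay in
`I` by solidity. -/
theorem exists_isModulusOn [HasSolidNorm E] {I : Set E} (hI : IsOrderIdeal I) (f : E →L[ℝ] ℝ) :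
    ∃ g, IsModulusOn I f g := by
  let S : E → Set ℝ := fun y => f '' {z | z ∈ I ∧ |z| ≤ y}
  have hbd : ∀ y, 0 ≤ y → ∀ r ∈ S y, r ≤ ‖f‖ * ‖y‖ := by
    rintro y hy _ ⟨z, ⟨-, hz⟩, rfl⟩
    refine (le_abs_self _).trans ((f.le_opNorm z).trans ?_)
    exact mul_le_mul_of_nonneg_left (norm_le_norm_of_abs_le_abs (by rwa [abs_of_nonneg hy]))
      (norm_nonneg f)
  have hne : ∀ y, 0 ≤ y → (0 : ℝ) ∈ S y := fun y hy =>
    ⟨0, ⟨hI.zero_mem, by simpa using hy⟩, by simp⟩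
  have hlub : ∀ y, 0 ≤ y → IsLUB (S y) (sSup (S y)) := fun y hy =>
    isLUB_csSup ⟨0, hne y hy⟩ ⟨_, hbd y hy⟩
  have hadd : ∀ a b, 0 ≤ a → 0 ≤ b → sSup (S (a + b)) = sSup (S a) + sSup (S b) := by
    intro a b ha hb
    refine le_antisymm ((hlub _ (add_nonneg ha hb)).2 ?_) ?_
    · rintro _ ⟨z, ⟨hzI, hz⟩, rfl⟩
      obtain ⟨z₁, z₂, rfl, h₁, h₂, h₃, h₄⟩ := riesz_decomposition ha hb hz
      rw [map_add]
      exact add_le_add ((hlub a ha).1 ⟨z₁, ⟨hI.solid hzI h₃, h₁⟩, rfl⟩)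
        ((hlub b hb).1 ⟨z₂, ⟨hI.solid hzI h₄, h₂⟩, rfl⟩)
    · rw [← le_sub_iff_add_le]
      refine (hlub a ha).2 ?_
      rintro _ ⟨z₁, ⟨hz₁, h₁⟩, rfl⟩
      rw [le_sub_comm]
      refine (hlub b hb).2 ?_
      rintro _ ⟨z₂, ⟨hz₂, h₂⟩, rfl⟩
      rw [le_sub_iff_add_le', ← map_add]
      exact (hlub _ (add_nonneg ha hb)).1
        ⟨_, ⟨hI.add_mem hz₁ hz₂, (abs_add_le _ _).trans (add_le_add h₁ h₂)⟩, rfl⟩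
  obtain ⟨g, hg⟩ := exists_continuousLinearMap_of_additive_on_cone hadd
    (fun a ha => (hlub a ha).1 (hne a ha)) (fun a ha => csSup_le ⟨0, hne a ha⟩ (hbd a ha))
  exact ⟨g, fun y hy => by rw [hg y hy]; exact hlub y hy⟩

namespace IsModulusOn

variable {I : Set E} {f g : E →L[ℝ] ℝ}

theorem nonneg (h : IsModulusOn I f g) (hI : IsOrderIdeal I) {y : E} (hy : 0 ≤ y) : 0 ≤ g y :=
  (h y hy).1 ⟨0, ⟨hI.zero_mem, by simpa using hy⟩, by simp⟩

theorem apply_le (h : IsModulusOn I f g) {z y : E} (hz : z ∈ I) (hzy : |z| ≤ y) : f z ≤ g y :=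
  (h y ((abs_nonneg z).trans hzy)).1 ⟨z, ⟨hz, hzy⟩, rfl⟩

theorem abs_apply_le (h : IsModulusOn I f g) (hI : IsOrderIdeal I) {z y : E} (hz : z ∈ I)
    (hzy : |z| ≤ y) : |f z| ≤ g y := by
  refine abs_le.2 ⟨?_, h.apply_le hz hzy⟩
  have := h.apply_le (hI.neg_mem hz) ((abs_neg z).le.trans hzy)
  rw [map_neg] at this
  linarith

theorem apply_eq_zero (h : IsModulusOn I f g) (hI : IsOrderIdeal I) {y : E} (hy : 0 ≤ y)
    (h0 : ∀ z ∈ I, |z| ≤ y → z = 0) : g y = 0 := by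
  refine le_antisymm ((h y hy).2 ?_) (h.nonneg hI hy)
  rintro _ ⟨z, ⟨hz, hzy⟩, rfl⟩
  rw [h0 z hz hzy, map_zero]

end IsModulusOn

variable [HasSolidNorm E]

/-- Choosing signs turns the left side into `h` of one vector dominated by `u`. -/
theorem sum_abs_apply_le_of_disjoint {ι : Type*} (s : Finset ι) {z : ι → E} {u : E} (hu : 0 ≤ u)
    (hz : ∀ i ∈ s, |z i| ≤ u) (hd : ∀ i ∈ s, ∀ j ∈ s, i ≠ j → |z i| ⊓ |z j| = 0)
    (h : E →L[ℝ] ℝ) : ∑ i ∈ s, |h (z i)| ≤ ‖h‖ * ‖u‖ := by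
  have hsign : ∀ i, ∃ w, |w| ≤ |z i| ∧ h w = |h (z i)| := fun i => by
    rcases abs_choice (h (z i)) with e | e
    · exact ⟨z i, le_rfl, e.symm⟩
    · exact ⟨-z i, (abs_neg _).le, by rw [map_neg, e]⟩
  choose w hw hhw using hsign
  calc ∑ i ∈ s, |h (z i)| = h (∑ i ∈ s, w i) := by
        rw [map_sum]
        exact Finset.sum_congr rfl fun i _ => (hhw i).symm
    _ ≤ ‖h‖ * ‖∑ i ∈ s, w i‖ := (le_abs_self _).trans (h.le_opNorm _)
    _ ≤ ‖h‖ * ‖u‖ := by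
      refine mul_le_mul_of_nonneg_left (norm_le_norm_of_abs_le_abs ?_) (norm_nonneg h)
      rw [abs_of_nonneg hu]
      refine (Finset.le_sum_of_subadditive (fun x : E => |x|) abs_zero.le abs_add_le s w).trans ?_
      exact (Finset.sum_le_sum fun i _ => hw i).trans (sum_abs_le_of_disjoint s hu hz hd)

/-- The moduli of a weakly null sequence of functionals on pairwise disjoint ideals form a weakly
null sequence. -/
theorem weaklyNull_of_isModulusOn {I : ℕ → Set E} (hI : ∀ n, IsOrderIdeal (I n))
    (hdisj : ∀ m n, m ≠ n → ∀ z, z ∈ I m → z ∈ I n → z = 0) {f g : ℕ → E →L[ℝ] ℝ}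
    (hf : WeaklyNull f) (hg : ∀ n, IsModulusOn (I n) (f n) (g n)) : WeaklyNull g := by
  refine weaklyNull_of_unit_ball fun φ hφ => ?_
  obtain ⟨U, hU, hUφ⟩ := exists_ultrafilter_tendsto_bidual hφ
  -- Near-maximizers for `g n |y|`. As `y` runs along `U`, their limits `ψ n` are bidual elements
  -- with `|φ (g n)|` at most `ψ n (f n)` up to `1 / (n + 1)`.
  have hz : ∀ n (y : E), ∃ z ∈ I n, |z| ≤ |y| ∧ g n |y| - 1 / ((n : ℝ) + 1) < f n z := fun n y =>
    (hg n).exists_lt (abs_nonneg y) (by positivity)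
  choose z hzI hzy hzf using hz
  have hψ : ∀ n, ∃ ψ : (E →L[ℝ] ℝ) →L[ℝ] ℝ, ∀ h : E →L[ℝ] ℝ,
      Tendsto (fun y => h (z n y)) U (𝓝 (ψ h)) := fun n =>
    exists_bidual_limit U (z n) (C := 1) (by
      filter_upwards [hU] with y hy
      exact (norm_le_norm_of_abs_le_abs (hzy n y)).trans hy)
  choose ψ hψ using hψ
  have hd : ∀ y m n, m ≠ n → |z m y| ⊓ |z n y| = 0 := by
    intro y m n hmn
    have hnn : 0 ≤ |z m y| ⊓ |z n y| := le_inf (abs_nonneg _) (abs_nonneg _)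
    refine hdisj m n hmn _ ((hI m).solid (hzI m y) ?_) ((hI n).solid (hzI n y) ?_)
    · rw [abs_of_nonneg hnn]; exact inf_le_left
    · rw [abs_of_nonneg hnn]; exact inf_le_right
  -- For fixed `y` the near-maximizers are disjoint and dominated by `|y|`, which is what the
  -- diagonal Schur lemma needs.
  have hsum : ∀ N h, ∑ m ∈ Finset.range N, |ψ m h| ≤ 1 * ‖h‖ := by
    intro N h
    refine le_of_tendsto (tendsto_finsetSum _ fun m _ => (hψ m h).abs) ?_
    filter_upwards [hU] with y hy
    refine (sum_abs_apply_le_of_disjoint _ (abs_nonneg y) (fun m _ => hzy m y)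
      (fun m _ n _ => hd y m n) h).trans ?_
    rw [norm_abs_eq_norm, mul_comm]
    exact mul_le_mul_of_nonneg_right hy (norm_nonneg h)
  have hle : ∀ n, |φ (g n)| ≤ ψ n (f n) + 1 / ((n : ℝ) + 1) := by
    intro n
    refine le_of_tendsto_of_tendsto (hUφ (g n)).abs ((hψ n (f n)).add_const _)
      (.of_forall fun y => ?_)
    have h₁ := abs_apply_le_apply_abs (fun y hy => (hg n).nonneg (hI n) hy) y
    have h₂ := hzf n y
    change |g n y| ≤ _
    linarith
  refine squeeze_zero_norm hle ?_
  simpa using (tendsto_diagonal_of_weaklyNull hsum hf).add tendsto_one_div_add_atTop_nhds_zero_nat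

/-- Take moduli `g` and `h` of `f` on the bands of all positive parts and of all negative parts.
These bands are disjoint, so the single functional `g - h` satisfies `|f |x n|| ≤ (g - h) (x n)` for
every `n`. -/
theorem WeaklyPSummable.abs {p : ℝ} (hp : 0 ≤ p) {x : ℕ → E} (hd : DisjointSeq x)
    (hx : WeaklyPSummable p x) : WeaklyPSummable p fun n => |x n| := by
  intro f
  have hI := isOrderIdeal_bandOf (Set.range fun n => (x n)⁺)
  have hJ := isOrderIdeal_bandOf (Set.range fun n => (x n)⁻)
  obtain ⟨g, hg⟩ := exists_isModulusOn hI f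
  obtain ⟨h, hh⟩ := exists_isModulusOn hJ f
  have hpos : ∀ n, |(x n)⁺| = (x n)⁺ := fun n => abs_of_nonneg (posPart_nonneg _)
  have hneg : ∀ n, |(x n)⁻| = (x n)⁻ := fun n => abs_of_nonneg (negPart_nonneg _)
  have hdisj : ∀ m n, (x m)⁺ ⊓ (x n)⁻ = 0 := by
    intro m n
    rcases eq_or_ne m n with rfl | hmn
    · exact posPart_inf_negPart_eq_zero _
    · refine le_antisymm ((inf_le_inf ?_ ?_).trans (hd m n hmn).le)
        (le_inf (posPart_nonneg _) (negPart_nonneg _))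
      · rw [← posPart_add_negPart (x m)]; exact le_add_of_nonneg_right (negPart_nonneg _)
      · rw [← posPart_add_negPart (x n)]; exact le_add_of_nonneg_left (posPart_nonneg _)
  refine (hx (g - h)).of_nonneg_of_le (fun n => Real.rpow_nonneg (abs_nonneg _) p) fun n => ?_
  refine Real.rpow_le_rpow (abs_nonneg _) (le_trans ?_ (le_abs_self _)) hp
  have h₁ := hg.abs_apply_le hI (subset_bandOf _ ⟨n, rfl⟩) (hpos n).le
  have h₂ := hh.abs_apply_le hJ (subset_bandOf _ ⟨n, rfl⟩) (hneg n).le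
  have h₃ : g (x n)⁻ = 0 := hg.apply_eq_zero hI (negPart_nonneg _) fun z hz hzy =>
    eq_zero_of_mem_bandOf hz (w := (x n)⁻) (by
      rintro _ ⟨m, rfl⟩
      rw [hneg, hpos, inf_comm]
      exact hdisj m n) (by rwa [hneg])
  have h₄ : h (x n)⁺ = 0 := hh.apply_eq_zero hJ (posPart_nonneg _) fun z hz hzy =>
    eq_zero_of_mem_bandOf hz (w := (x n)⁺) (by
      rintro _ ⟨m, rfl⟩
      rw [hneg, hpos]
      exact hdisj n m) (by rwa [hpos])
  have e : (g - h) (x n) = g (x n)⁺ + h (x n)⁻ := by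
    conv_lhs => rw [← posPart_sub_negPart (x n)]
    simp only [_root_.sub_apply, map_sub, h₃, h₄]
    ring
  rw [e]
  change |f (|x n|)| ≤ _
  rw [← posPart_add_negPart (x n), map_add]
  exact (abs_add_le _ _).trans (add_le_add h₁ h₂)

/-- Disjointness of positive functionals. -/
def DisjointFunctionals (g h : E →L[ℝ] ℝ) : Prop :=
  ∀ y, 0 ≤ y → ∀ δ > 0, ∃ a b, 0 ≤ a ∧ 0 ≤ b ∧ a + b = y ∧ g a ≤ δ ∧ h b ≤ δ

/-- Use the modulus of `f n` on the band of `x n`; distinct bands meet only in zero. -/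
theorem exists_positive_disjoint_weaklyNull {x : ℕ → E} (hx : DisjointSeq x)
    {f : ℕ → E →L[ℝ] ℝ} (hf : WeaklyNull f) :
    ∃ g : ℕ → E →L[ℝ] ℝ, (∀ n y, 0 ≤ y → 0 ≤ g n y) ∧ WeaklyNull g ∧
      (∀ m n, m ≠ n → DisjointFunctionals (g m) (g n)) ∧ ∀ n, |f n (x n)| ≤ g n |x n| := by
  have hI : ∀ n, IsOrderIdeal (bandOf {x n}) := fun n => isOrderIdeal_bandOf _
  choose g hg using fun n => exists_isModulusOn (hI n) (f n)
  have hdisj : ∀ m n, m ≠ n → ∀ z, z ∈ bandOf {x m} → z ∈ bandOf {x n} → z = 0 :=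
    fun m n hmn z => eq_zero_of_mem_bandOf_of_mem_bandOf (hx m n hmn)
  refine ⟨g, fun n y => (hg n).nonneg (hI n), weaklyNull_of_isModulusOn hI hdisj hf hg,
    fun m n hmn y hy δ hδ => ?_,
    fun n => (hg n).abs_apply_le (hI n) (subset_bandOf _ rfl) le_rfl⟩
  -- A near-maximizer for `g m` carries all but `δ` of `g m y`, and `g n` vanishes on `|z|`.
  obtain ⟨z, hz, hzy, hlt⟩ := (hg m).exists_lt hy hδ
  refine ⟨y - |z|, |z|, sub_nonneg.2 hzy, abs_nonneg z, sub_add_cancel _ _, ?_, ?_⟩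
  · have := (hg m).apply_le hz le_rfl
    rw [map_sub]
    linarith
  · rw [(hg n).apply_eq_zero (hI n) (abs_nonneg z) fun w hw hwz =>
      hdisj m n hmn w ((hI m).solid hz hwz) hw]
    exact hδ.le

end Modulus

/-! ### Diagonal and positive criteria for the disjoint Dunford–Pettis property. -/

section Criterion

variable {E : Type*} [NormedAddCommGroup E] [NormedSpace ℝ E] [Lattice E]

theorem DisjointDPP.tendsto {p : ℝ} (hE : DisjointDPP p E) {x : ℕ → E} (hd : DisjointSeq x)
    (hx : WeaklyPSummable p x) {f : ℕ → E →L[ℝ] ℝ} (hf : WeaklyNull f) :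
    Tendsto (fun n => f n (x n)) atTop (𝓝 0) := by
  rw [Metric.tendsto_nhds]
  intro ε hε
  filter_upwards [Metric.tendstoUniformlyOn_iff.1 (hE x hd hx f hf) ε hε] with n hn
  rw [dist_comm]
  exact hn (x n) ⟨n, rfl⟩

/-- If the property fails, it fails along the diagonal of sequences. -/
theorem disjointDPP_of_tendsto_diagonal {p : ℝ}
    (H : ∀ (x : ℕ → E) (f : ℕ → E →L[ℝ] ℝ), DisjointSeq x → WeaklyPSummable p x → WeaklyNull f →
      Tendsto (fun n => f n (x n)) atTop (𝓝 0)) : DisjointDPP p E := by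
  intro x hd hx f hf
  by_contra hcon
  simp only [Metric.tendstoUniformlyOn_iff, not_forall, exists_prop] at hcon
  obtain ⟨ε, hε, hne⟩ := hcon
  have hfreq : ∃ᶠ n in atTop, ∃ m, ε ≤ |f n (x m)| := (not_eventually.1 hne).mono fun n hn => by
    push Not at hn
    obtain ⟨_, ⟨m, rfl⟩, hm⟩ := hn
    exact ⟨m, by simpa [dist_eq_norm] using hm⟩
  -- On finitely many points `f n` is eventually below `ε`, so late bad indices force a new point:
  -- both coordinates can increase.
  have hstep : ∀ q : ℕ × ℕ, ∃ q' : ℕ × ℕ, q.1 < q'.1 ∧ q.2 < q'.2 ∧ ε ≤ |f q'.1 (x q'.2)| := by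
    rintro ⟨n, m⟩
    have hev : ∀ᶠ n' in atTop, ∀ m' ∈ Finset.range (m + 1), |f n' (x m')| < ε := by
      rw [Finset.eventually_all]
      intro m' _
      have := (hf (NormedSpace.inclusionInDoubleDual ℝ E (x m'))).abs
      rw [abs_zero] at this
      exact this.eventually_lt_const hε
    obtain ⟨n', ⟨m', hm'⟩, hn', hlt⟩ :=
      (hfreq.and_eventually (hev.and (eventually_gt_atTop n))).exists
    refine ⟨(n', m'), hlt, ?_, hm'⟩
    by_contra hle
    exact absurd hm' (not_le.2 (hn' m' (Finset.mem_range.2 (by simp only [not_lt] at hle; omega))))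
  choose next h₁ h₂ h₃ using hstep
  -- Starting at `i + 1` makes every `s i` a value of `next`, hence bad; the seed `(0, 0)` need not
  -- be.
  set s : ℕ → ℕ × ℕ := fun i => next^[i + 1] (0, 0)
  have hsucc : ∀ i, s (i + 1) = next (s i) := fun i => Function.iterate_succ_apply' _ _ _
  have hm₁ : StrictMono fun i => (s i).1 := strictMono_nat_of_lt_succ fun i => by
    rw [hsucc]; exact h₁ _
  have hm₂ : StrictMono fun i => (s i).2 := strictMono_nat_of_lt_succ fun i => by
    rw [hsucc]; exact h₂ _
  have ht := (H (x ∘ fun i => (s i).2) (f ∘ fun i => (s i).1)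
    (hd.comp_injective hm₂.injective) (hx.comp_injective hm₂.injective)
    (hf.comp_strictMono hm₁)).abs
  have := ge_of_tendsto' ht (b := ε) fun i => by
    change ε ≤ |f (s i).1 (x (s i).2)|
    have : s i = next (next^[i] (0, 0)) := Function.iterate_succ_apply' _ _ _
    rw [this]
    exact h₃ _
  rw [abs_zero] at this
  linarith

/-- The common entrance for the implications back to the disjoint property. -/
theorem disjointDPP_of_positive [IsOrderedAddMonoid E] [HasSolidNorm E] {p : ℝ} (hp : 0 ≤ p)
    (H : ∀ (x : ℕ → E) (g : ℕ → E →L[ℝ] ℝ), DisjointSeq x → WeaklyPSummable p x → (∀ n, 0 ≤ x n) →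
      (∀ n y, 0 ≤ y → 0 ≤ g n y) → WeaklyNull g →
      (∀ m n, m ≠ n → DisjointFunctionals (g m) (g n)) →
      Tendsto (fun n => g n (x n)) atTop (𝓝 0)) : DisjointDPP p E := by
  refine disjointDPP_of_tendsto_diagonal fun x f hd hx hf => ?_
  obtain ⟨g, hg, hgw, hgd, hle⟩ := exists_positive_disjoint_weaklyNull hd hf
  exact squeeze_zero_norm hle
    (H (fun n => |x n|) g hd.abs (hx.abs hp hd) (fun n => abs_nonneg _) hg hgw hgd)

end Criterion

/-! ### The polarization formula. -/

section Polarization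

variable {k : ℕ} {V W : Type*} [AddCommGroup V] [Module ℝ V] [AddCommGroup W] [Module ℝ W]

/-- The polarization of a map `P`. -/
def polar (k : ℕ) (P : V → W) (v : Fin k → V) : W :=
  (k.factorial : ℝ)⁻¹ • ∑ u : Finset (Fin k), (-1 : ℝ) ^ u.card • P (∑ i ∈ uᶜ, v i)

/-- The polarization formula: a symmetric multilinear map is determined by its diagonal. -/
theorem MultilinearMap.polar_diagonal (T : MultilinearMap ℝ (fun _ : Fin k => V) W)
    (hT : ∀ (σ : Equiv.Perm (Fin k)) (v : Fin k → V), T (fun i => v (σ i)) = T v)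
    (v : Fin k → V) : polar k (fun x => T fun _ => x) v = T v := by
  classical
  have hexp : ∀ u : Finset (Fin k), (T fun _ => ∑ i ∈ uᶜ, v i) =
      ∑ r : Fin k → Fin k, if u ⊆ (Finset.univ.image r)ᶜ then T (fun i => v (r i)) else 0 := by
    intro u
    rw [T.map_sum_finset (fun _ j => v j) fun _ => uᶜ, ← Finset.sum_filter]
    refine Finset.sum_congr ?_ fun _ _ => rfl
    ext r
    simp only [Fintype.mem_piFinset, Finset.mem_compl, Finset.mem_filter, Finset.mem_univ, true_and,
      Finset.subset_iff, Finset.mem_image, not_exists]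
    exact ⟨fun h j hj i hi => h i (hi ▸ hj), fun h i hi => h hi i rfl⟩
  -- Inclusion–exclusion: the alternating sum over subsets of the complement of the range of `r`
  -- vanishes unless `r` is onto.
  have hinner : ∀ r : Fin k → Fin k, (∑ u : Finset (Fin k), (-1 : ℝ) ^ u.card •
      if u ⊆ (Finset.univ.image r)ᶜ then T (fun i => v (r i)) else 0) =
      if Function.Surjective r then T (fun i => v (r i)) else 0 := by
    intro r
    have h1 : (∑ u ∈ (Finset.univ.image r)ᶜ.powerset, (-1 : ℝ) ^ u.card) =
        if (Finset.univ.image r)ᶜ = ∅ then 1 else 0 := by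
      exact_mod_cast Finset.sum_powerset_neg_one_pow_card (x := (Finset.univ.image r)ᶜ)
    have h2 : (Finset.univ.image r)ᶜ = ∅ ↔ Function.Surjective r := by
      simp [Finset.compl_eq_empty_iff, Finset.eq_univ_iff_forall, Function.Surjective]
    simp only [smul_ite, smul_zero]
    rw [← Finset.sum_filter, ← Finset.sum_smul]
    have h3 : (Finset.univ.filter fun u : Finset (Fin k) => u ⊆ (Finset.univ.image r)ᶜ) =
        (Finset.univ.image r)ᶜ.powerset := by
      ext u; simp
    rw [h3, h1]
    simp only [h2]
    split_ifs <;> simp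
  have hperm : (∑ r : Fin k → Fin k, if Function.Surjective r then T (fun i => v (r i)) else 0) =
      ∑ σ : Equiv.Perm (Fin k), T (fun i => v (σ i)) := by
    symm
    refine Finset.sum_of_injOn (fun σ => ⇑σ) (fun _ _ _ _ h => DFunLike.coe_injective h)
      (fun _ _ => Finset.mem_coe.2 (Finset.mem_univ _)) (fun r _ hr => if_neg fun hs => hr ?_)
      fun σ _ => (if_pos σ.surjective).symm
    exact ⟨Equiv.ofBijective r (Finite.injective_iff_surjective.2 hs |>.bijective_of_finite),
      by simp, rfl⟩
  have htotal : (∑ u : Finset (Fin k), (-1 : ℝ) ^ u.card • T fun _ => ∑ i ∈ uᶜ, v i) =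
      (k.factorial : ℝ) • T v := by
    simp_rw [hexp, Finset.smul_sum]
    rw [Finset.sum_comm]
    simp_rw [hinner]
    rw [hperm]
    simp [hT, Fintype.card_perm, Nat.cast_smul_eq_nsmul]
  rw [polar, htotal, inv_smul_smul₀ (by positivity)]

end Polarization

/-! ### From the disjoint property to polynomials. -/

section DunfordPettis

theorem norm_sum_le_of_unit_ball {V : Type*} [SeminormedAddCommGroup V] {k : ℕ}
    {v : Fin k → V} (hv : ∀ i, ‖v i‖ ≤ 1) (u : Finset (Fin k)) : ‖∑ i ∈ u, v i‖ ≤ k := by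
  refine (norm_sum_le_of_le u fun i _ => hv i).trans ?_
  simpa using Finset.card_le_univ u

variable {E : Type*} [NormedAddCommGroup E] [NormedSpace ℝ E]

/-- Closedness of `𝓚` in the product topology is exactly what Goldstine needs to replace a unit
vector by a bidual element. -/
theorem bidual_apply_mem {ι : Type*} {𝓚 : Set (ι → ℝ)} (h𝓚 : IsClosed 𝓚) {g : ι → E →L[ℝ] ℝ}
    (hg : ∀ y, ‖y‖ ≤ 1 → (fun i => g i y) ∈ 𝓚) {φ : (E →L[ℝ] ℝ) →L[ℝ] ℝ} (hφ : ‖φ‖ ≤ 1) :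
    (fun i => φ (g i)) ∈ 𝓚 := by
  refine closure_minimal ?_ h𝓚 (bidual_mem_closure g hφ)
  rintro _ ⟨y, hy, rfl⟩
  exact hg y (by simpa using hy)

variable [Lattice E]

/-- In a space with the disjoint Dunford-Pettis property, a sequence of multilinear forms that
converges on all iterated bidual limits of points of the unit ball tends to zero along disjoint
weakly `p`-summable sequences. -/
theorem DisjointDPP.tendsto_multilinear {p : ℝ} (hp : 0 < p) (hE : DisjointDPP p E) {x : ℕ → E}
    (hd : DisjointSeq x) (hx : WeaklyPSummable p x) (k : ℕ)
    (Λ : Option ℕ → ContinuousMultilinearMap ℝ (fun _ : Fin (k + 1) => E) ℝ)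
    {𝓚 : Set (Option ℕ → ℝ)} (h𝓚 : IsClosed 𝓚)
    (hΛ : ∀ v : Fin (k + 1) → E, (∀ i, ‖v i‖ ≤ 1) → (fun i => Λ i v) ∈ 𝓚)
    (hlim : ∀ c ∈ 𝓚, Tendsto (fun n => c (some n)) atTop (𝓝 (c none))) :
    Tendsto (fun n => Λ (some n) fun _ => x n) atTop (𝓝 0) := by
  have hsnoc : ∀ (k : ℕ) (v : Fin k → E) (y : E), (∀ i, ‖v i‖ ≤ 1) → ‖y‖ ≤ 1 →
      ∀ i : Fin (k + 1), ‖(Fin.snoc v y : Fin (k + 1) → E) i‖ ≤ 1 := by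
    intro k v y hv hy i
    refine Fin.lastCases ?_ (fun j => ?_) i
    · simpa using hy
    · simpa using hv j
  have hconst : ∀ (k : ℕ) (y : E), (Fin.snoc (fun _ => y) y : Fin (k + 1) → E) = fun _ => y := by
    intro k y
    funext i
    refine Fin.lastCases ?_ (fun j => ?_) i <;> simp
  induction k with
  | zero =>
    let g : Option ℕ → E →L[ℝ] ℝ := fun i => (Λ i).curryRight fun _ => 0
    have hg : ∀ i y, g i y = Λ i fun _ => y := fun i y => by
      change Λ i _ = _
      congr 1
    -- The index `none` carries the limit form; subtracting it gives a weakly null sequence, and the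
    -- limit itself vanishes along `x` by weak summability.
    have hw : WeaklyNull fun n => g (some n) - g none := weaklyNull_of_unit_ball fun φ hφ => by
      have hmem := bidual_apply_mem h𝓚 (g := g) (fun y hy => by
        simpa only [hg] using hΛ (fun _ => y) fun _ => hy) hφ
      simpa using (hlim _ hmem).sub_const (φ (g none))
    have := (hE.tendsto hd hx hw).add (hx.tendsto hp (g none))
    simpa [hg] using this
  | succ k ih =>
    -- Applying `φ` to the free slot gives forms in one variable fewer with values in the same `𝓚`,
    -- so the induction hypothesis is the weak nullity sought.
    have hw : WeaklyNull fun n => (Λ (some n)).curryRight fun _ => x n :=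
      weaklyNull_of_unit_ball fun φ hφ =>
        ih (fun i => φ.compContinuousMultilinearMap (Λ i).curryRight) fun v hv =>
          bidual_apply_mem h𝓚 (g := fun i => (Λ i).curryRight v)
            (fun y hy => hΛ (Fin.snoc v y) (hsnoc _ v y hv hy)) hφ
    refine (hE.tendsto hd hx hw).congr fun n => ?_
    rw [ContinuousMultilinearMap.curryRight_apply]
    exact congrArg _ (hconst _ _)

/-- Norming functionals along a bad subsequence converge, after extraction, on a weakly compact set
containing all values of `T` on unit tuples; the multilinear lemma then contradicts the lower bound
`ε`. -/
theorem DisjointDPP.disjointPConvergent {F : Type*} [NormedAddCommGroup F] [NormedSpace ℝ F]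
    [PartialOrder F] {p : ℝ} (hp : 0 < p) (hE : DisjointDPP p E) {k : ℕ}
    (hk : 1 ≤ k) {P : E → F} (hP : IsPosHomPoly k P) (hPc : WeaklyCompactMap P) :
    DisjointPConvergent p P := by
  obtain ⟨k, rfl⟩ : ∃ m, k = m + 1 := ⟨k - 1, by omega⟩
  obtain ⟨T, hT, -, hPT⟩ := hP
  intro x hd hx
  by_contra hcon
  obtain ⟨ε, hε, hfreq⟩ : ∃ ε > 0, ∃ᶠ n in atTop, ε ≤ ‖P (x n)‖ := by
    simp only [Metric.tendsto_nhds, not_forall, exists_prop] at hcon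
    obtain ⟨ε, hε, h⟩ := hcon
    exact ⟨ε, hε, (not_eventually.1 h).mono fun n hn => by simpa using hn⟩
  obtain ⟨r, hr, hbad⟩ := extraction_of_frequently_atTop hfreq
  choose f hf hfx using fun n => exists_dual_vector'' ℝ (P (x (r n)))
  set K₀ := closure (toWeakSpace ℝ F '' (P '' Metric.closedBall 0 1))
  -- Polarization as a weakly continuous map on tuples from `K₀`. The factor `(k + 1) ^ (k + 1)`
  -- undoes scaling a sum of at most `k + 1` unit vectors into the ball.
  let comb : (Finset (Fin (k + 1)) → WeakSpace ℝ F) → WeakSpace ℝ F := fun z =>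
    ((k + 1).factorial : ℝ)⁻¹ • ∑ u, (-1 : ℝ) ^ u.card • (((k + 1 : ℕ) : ℝ) ^ (k + 1)) • z u
  have hcomb : Continuous comb := by
    refine Continuous.const_smul (continuous_finsetSum _ fun u _ => ?_) _
    exact ((continuous_apply u).const_smul _).const_smul _
  have hK : IsCompact (comb '' Set.univ.pi fun _ => K₀) :=
    (isCompact_univ_pi fun _ => hPc).image hcomb
  have hTK : ∀ v : Fin (k + 1) → E, (∀ i, ‖v i‖ ≤ 1) →
      toWeakSpace ℝ F (T v) ∈ comb '' Set.univ.pi fun _ => K₀ := by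
    intro v hv
    have hk0 : ((k + 1 : ℕ) : ℝ) ≠ 0 := by positivity
    let w : Finset (Fin (k + 1)) → E := fun u => ((k + 1 : ℕ) : ℝ)⁻¹ • ∑ i ∈ uᶜ, v i
    have hw : ∀ u, ∑ i ∈ uᶜ, v i = ((k + 1 : ℕ) : ℝ) • w u := fun u => (smul_inv_smul₀ hk0 _).symm
    refine ⟨fun u => toWeakSpace ℝ F (P (w u)),
      fun u _ => subset_closure ⟨_, ⟨w u, ?_, rfl⟩, rfl⟩, ?_⟩
    · rw [mem_closedBall_zero_iff, norm_smul, norm_inv, Real.norm_of_nonneg (Nat.cast_nonneg _)]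
      exact inv_mul_le_one_of_le₀ (norm_sum_le_of_unit_ball hv _) (Nat.cast_nonneg _)
    · have h := T.toMultilinearMap.polar_diagonal hT v
      change _ = toWeakSpace ℝ F (T.toMultilinearMap v)
      rw [← h]
      simp only [comb, polar, map_smul, map_sum]
      congr 1
      refine Finset.sum_congr rfl fun u _ => ?_
      rw [hw u, hPT, ← map_smul]
      congr 2
      have := T.map_smul_univ (fun _ => ((k + 1 : ℕ) : ℝ)) fun _ => w u
      simpa using this.symm
  obtain ⟨s, g, hs, hg⟩ := exists_subseq_tendsto_on_weaklyCompact hK f hf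
  let h : Option ℕ → F →L[ℝ] ℝ := fun i => i.elim g fun n => f (s n)
  let ev : WeakSpace ℝ F → Option ℕ → ℝ := fun z i => h i ((toWeakSpace ℝ F).symm z)
  have hev : Continuous ev := continuous_pi fun i => WeakBilin.eval_continuous _ (h i)
  have hinj := (hr.comp hs).injective
  have key := hE.tendsto_multilinear hp (hd.comp_injective hinj) (hx.comp_injective hinj) k
    (fun i => (h i).compContinuousMultilinearMap T) (hK.image hev).isClosed
    (fun v hv => ⟨_, hTK v hv, rfl⟩) (by
      rintro _ ⟨z, hz, rfl⟩
      exact hg ((toWeakSpace ℝ F).symm z) hz)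
  have hge := ge_of_tendsto' key (b := ε) fun n => by
    change ε ≤ f (s n) (T fun _ => x (r (s n)))
    rw [← hPT, hfx]
    exact hbad _
  linarith

theorem RegPoly.exists_symmetric_multilinear {k : ℕ} (P : RegPoly k E) :
    ∃ T : ContinuousMultilinearMap ℝ (fun _ : Fin k => E) ℝ,
      (∀ (σ : Equiv.Perm (Fin k)) (v : Fin k → E), T (fun i => v (σ i)) = T v) ∧
      ∀ x, P x = T fun _ => x := by
  obtain ⟨P₁, P₂, ⟨T, hT, _, hPT⟩, ⟨S, hS, _, hPS⟩, hP⟩ := P.exists_eq_sub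
  exact ⟨T - S, fun σ v => by simp [hT σ v, hS σ v], fun x => by simp [hP, hPT, hPS]⟩

variable [IsOrderedAddMonoid E] [HasSolidNorm E]

namespace RegPoly

variable {k : ℕ}

theorem abs_apply_le_norm (P : RegPoly k E) (x : E) : |P x| ≤ ‖P‖ * ‖x‖ ^ k := by
  rcases eq_or_ne x 0 with rfl | hx
  · rcases eq_or_ne k 0 with rfl | hk
    · simpa using! P.abs_apply_le_regNorm (x := 0) (by simp)
    · have : P 0 = 0 := by simpa [hk] using P.map_smul_self 0 0
      simp [this, hk]
  · have hx' : 0 < ‖x‖ := norm_pos_iff.2 hx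
    have h := P.abs_apply_le_regNorm (x := ‖x‖⁻¹ • x) (by rw [norm_smul]; simp [hx'.ne'])
    conv_lhs => rw [← smul_inv_smul₀ hx'.ne' x, map_smul_self, abs_mul, abs_pow, abs_norm, mul_comm]
    exact mul_le_mul_of_nonneg_right h (by positivity)

/-- Evaluation at a point as a functional on `𝒫ʳ(ᵏE)`. -/
def evalCLM (k : ℕ) (x : E) : RegPoly k E →L[ℝ] ℝ :=
  LinearMap.mkContinuous
    { toFun := fun P => P x
      map_add' := fun _ _ => rfl
      map_smul' := fun _ _ => rfl } (‖x‖ ^ k)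
    fun P => (P.abs_apply_le_norm x).trans_eq (mul_comm _ _)

theorem norm_evalCLM_le (x : E) : ‖evalCLM k x‖ ≤ ‖x‖ ^ k :=
  LinearMap.mkContinuous_norm_le _ (by positivity) _

end RegPoly

/-- By polarization, the value at a unit tuple of the form of `P n` is a functional on `RegPoly`, of
norm at most `C`, applied to `P n`. Weak nullity gives limit zero on the whole dual ball. -/
theorem DisjointDPP.tendsto_regPoly {p : ℝ} (hp : 0 < p) (hE : DisjointDPP p E) {k : ℕ}
    (hk : 1 ≤ k) {x : ℕ → E} (hd : DisjointSeq x) (hx : WeaklyPSummable p x)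
    {P : ℕ → RegPoly k E} (hP : WeaklyNull P) :
    Tendsto (fun n => P n (x n)) atTop (𝓝 0) := by
  obtain ⟨k, rfl⟩ : ∃ m, k = m + 1 := ⟨k - 1, by omega⟩
  let Q : Option ℕ → RegPoly (k + 1) E := fun i => i.elim 0 P
  choose T hT hPT using fun i => (Q i).exists_symmetric_multilinear
  set C : ℝ := ((k + 1).factorial : ℝ)⁻¹ *
    ∑ _u : Finset (Fin (k + 1)), ((k + 1 : ℕ) : ℝ) ^ (k + 1)
  let ev : WeakDual ℝ (RegPoly (k + 1) E) → Option ℕ → ℝ := fun κ i => κ (Q i)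
  have hev : Continuous ev := continuous_pi fun i => WeakDual.eval_continuous (Q i)
  have hK := (WeakDual.isCompact_closedBall (𝕜 := ℝ) (E := RegPoly (k + 1) E) 0 C).image hev
  refine (hE.tendsto_multilinear hp hd hx k T hK.isClosed (fun v hv => ?_) ?_).congr fun n =>
    (hPT (some n) (x n)).symm
  · let κ : RegPoly (k + 1) E →L[ℝ] ℝ := ((k + 1).factorial : ℝ)⁻¹ •
      ∑ u : Finset (Fin (k + 1)), (-1 : ℝ) ^ u.card • RegPoly.evalCLM (k + 1) (∑ i ∈ uᶜ, v i)
    refine ⟨StrongDual.toWeakDual κ, ?_, ?_⟩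
    · have : ‖κ‖ ≤ C := by
        rw [norm_smul, norm_inv, Real.norm_of_nonneg (Nat.cast_nonneg _)]
        refine mul_le_mul_of_nonneg_left (norm_sum_le_of_le _ fun u _ => ?_) (by positivity)
        rw [norm_smul, norm_pow, norm_neg, norm_one, one_pow, one_mul]
        exact (RegPoly.norm_evalCLM_le _).trans
          (pow_le_pow_left₀ (norm_nonneg _) (norm_sum_le_of_unit_ball hv _) _)
      simpa using this
    · funext i
      have h := (T i).toMultilinearMap.polar_diagonal (hT i) v
      refine Eq.trans ?_ h
      change κ (Q i) = _
      simp only [κ, polar, smul_apply, FunLike.coe_sum, Finset.sum_apply, smul_eq_mul]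
      congr 1
      refine Finset.sum_congr rfl fun u _ => ?_
      congr 1
      exact hPT i _
  · rintro _ ⟨κ, -, rfl⟩
    have := hP (WeakDual.toStrongDual κ)
    simpa [ev, Q] using this

end DunfordPettis

/-! ### Powers of positive functionals in `RegPoly`. -/

section PowerPolynomials

theorem tendsto_zero_of_pow {a : ℕ → ℝ} (ha : ∀ n, 0 ≤ a n) {k : ℕ}
    (h : Tendsto (fun n => a n ^ k) atTop (𝓝 0)) : Tendsto a atTop (𝓝 0) := by
  rw [Metric.tendsto_nhds] at h ⊢
  intro ε hε
  filter_upwards [h (ε ^ k) (by positivity)] with n hn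
  rw [Real.dist_0_eq_abs, abs_of_nonneg (by have := ha n; positivity)] at hn ⊢
  · exact lt_of_pow_lt_pow_left₀ k hε.le hn

theorem prod_le_mul_pow {k : ℕ} {c : Fin k → ℝ} {C δ : ℝ} (hC : 1 ≤ C) (hc : ∀ i, 0 ≤ c i)
    (hcC : ∀ i, c i ≤ C) (hδ : ∃ j, c j ≤ δ) : ∏ i, c i ≤ δ * C ^ k := by
  obtain ⟨j, hj⟩ := hδ
  have hδ0 : 0 ≤ δ := (hc j).trans hj
  rw [← Finset.mul_prod_erase _ _ (Finset.mem_univ j)]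
  refine mul_le_mul hj ?_ (Finset.prod_nonneg fun i _ => hc i) hδ0
  refine (Finset.prod_le_prod (fun i _ => hc i) fun i _ => hcC i).trans ?_
  rw [Finset.prod_const]
  exact pow_le_pow_right₀ hC ((Finset.card_le_univ _).trans_eq (Fintype.card_fin k))

variable {E : Type*} [NormedAddCommGroup E] [NormedSpace ℝ E]

/-- The form `v ↦ ∏ i, g (v i)`. -/
def powForm (k : ℕ) (g : E →L[ℝ] ℝ) : ContinuousMultilinearMap ℝ (fun _ : Fin k => E) ℝ :=
  (ContinuousMultilinearMap.mkPiAlgebra ℝ (Fin k) ℝ).compContinuousLinearMap fun _ => g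

@[simp]
theorem powForm_apply (k : ℕ) (g : E →L[ℝ] ℝ) (v : Fin k → E) : powForm k g v = ∏ i, g (v i) := rfl

theorem powForm_perm (k : ℕ) (g : E →L[ℝ] ℝ) (σ : Equiv.Perm (Fin k)) (v : Fin k → E) :
    powForm k g (fun i => v (σ i)) = powForm k g v :=
  Equiv.prod_comp σ fun i => g (v i)

variable [Lattice E]

theorem isPosHomPoly_pow (k : ℕ) {g : E →L[ℝ] ℝ} (hg : ∀ y, 0 ≤ y → 0 ≤ g y) :
    IsPosHomPoly k fun x => g x ^ k :=
  ⟨powForm k g, powForm_perm k g, fun v hv => by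
    rw [powForm_apply]
    exact Finset.prod_nonneg fun i _ => hg _ (hv i), by simp⟩

variable [IsOrderedAddMonoid E]

namespace RegPoly

variable {k : ℕ}

theorem isAbs_self {P : RegPoly k E} (hP : 0 ≤ P) : IsAbs P P := by
  refine ⟨?_, fun R hR => hR (by simp)⟩
  rintro R (rfl | rfl)
  · exact le_rfl
  · exact (neg_nonpos.2 hP).trans hP

theorem ofPos_nonneg {P : E → ℝ} (hP : IsPosHomPoly k P) : 0 ≤ ofPos hP := by
  rw [le_iff]
  simpa using hP

/-- Polarization identifies the positive form witnessing `hR` with `powForm k g - S`. -/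
theorem apply_le_powForm {g : E →L[ℝ] ℝ} (hg : ∀ y, 0 ≤ y → 0 ≤ g y) {R : RegPoly k E}
    (hR : R ≤ ofPos (isPosHomPoly_pow k hg))
    {S : ContinuousMultilinearMap ℝ (fun _ : Fin k => E) ℝ}
    (hS : ∀ (σ : Equiv.Perm (Fin k)) (v : Fin k → E), S (fun i => v (σ i)) = S v)
    (hRS : ∀ x, R x = S fun _ => x) {v : Fin k → E} (hv : ∀ i, 0 ≤ v i) :
    S v ≤ ∏ i, g (v i) := by
  obtain ⟨T, hT, hT0, hTR⟩ := le_iff.1 hR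
  have h₁ := T.toMultilinearMap.polar_diagonal hT v
  have h₂ := (powForm k g - S).toMultilinearMap.polar_diagonal
    (fun σ v => by
      change powForm k g _ - S _ = powForm k g _ - S _
      rw [powForm_perm, hS]) v
  have e : (fun x => T.toMultilinearMap fun _ => x) =
      fun x => (powForm k g - S).toMultilinearMap fun _ => x := by
    funext x
    change T _ = powForm k g _ - S _
    rw [← hTR, ← hRS]
    simp
  rw [e, h₂] at h₁
  have h₃ := hT0 v hv
  change powForm k g v - S v = T v at h₁
  rw [powForm_apply] at h₁
  linarith

/-- Split each `v i` as `a i + b i` with `g (a i)` and `h (b i)` at most `δ`. Each of the `2 ^ k`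
terms of the expanded form `S` has an `a` slot, controlled through `g`, or only `b` slots,
controlled through `h`; let `δ → 0`. -/
theorem isGLB_pow_of_disjoint (hk : 1 ≤ k) {g h : E →L[ℝ] ℝ} (hg : ∀ y, 0 ≤ y → 0 ≤ g y)
    (hh : ∀ y, 0 ≤ y → 0 ≤ h y) (hd : DisjointFunctionals g h) :
    IsGLB {ofPos (isPosHomPoly_pow k hg), ofPos (isPosHomPoly_pow k hh)} 0 := by
  classical
  refine ⟨?_, fun R hR => ?_⟩
  · rintro _ (rfl | rfl) <;> exact ofPos_nonneg _
  obtain ⟨S, hS, hRS⟩ := R.exists_symmetric_multilinear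
  refine le_iff.2 ⟨-S, fun σ v => by simp [hS σ v], fun v hv => ?_, fun x => by simp [hRS]⟩
  set C : ℝ := 1 + ∑ i, (g (v i) + h (v i)) with hC
  have hnn : ∀ i, 0 ≤ g (v i) + h (v i) := fun i => add_nonneg (hg _ (hv i)) (hh _ (hv i))
  have hC1 : 1 ≤ C := le_add_of_nonneg_right (Finset.sum_nonneg fun i _ => hnn i)
  have hCi : ∀ i, g (v i) + h (v i) ≤ C := fun i =>
    (Finset.single_le_sum (fun j _ => hnn j) (Finset.mem_univ i)).trans (by rw [hC]; linarith)
  have hbound : ∀ δ > 0, S v ≤ δ * (2 ^ k * C ^ k) := by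
    intro δ hδ
    choose a b ha hb hab hga hhb using fun i => hd (v i) (hv i) δ hδ
    have hav : ∀ i, a i ≤ v i := fun i => by rw [← hab i]; exact le_add_of_nonneg_right (hb i)
    have hbv : ∀ i, b i ≤ v i := fun i => by rw [← hab i]; exact le_add_of_nonneg_left (ha i)
    have hv' : v = a + b := funext fun i => (hab i).symm
    rw [hv', S.map_add_univ]
    have hterm : ∀ s : Finset (Fin k), S (s.piecewise a b) ≤ δ * C ^ k := by
      intro s
      have h0 : ∀ i, 0 ≤ s.piecewise a b i := fun i => by
        by_cases hi : i ∈ s <;> simp [hi, ha, hb]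
      have hle : ∀ i, s.piecewise a b i ≤ v i := fun i => by
        by_cases hi : i ∈ s <;> simp [hi, hav, hbv]
      rcases s.eq_empty_or_nonempty with rfl | ⟨j, hj⟩
      -- All slots are `b`; `1 ≤ k` guarantees that slot `0` exists.
      · refine (apply_le_powForm hh (hR (by simp)) hS hRS h0).trans
          (prod_le_mul_pow hC1 (fun i => hh _ (h0 i)) (fun i => ?_) ⟨⟨0, hk⟩, ?_⟩)
        · have := apply_le_apply_of_le hh (hle i)
          linarith [hCi i, hg _ (hv i)]
        · simpa using hhb _
      · refine (apply_le_powForm hg (hR (by simp)) hS hRS h0).trans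
          (prod_le_mul_pow hC1 (fun i => hg _ (h0 i)) (fun i => ?_) ⟨j, ?_⟩)
        · have := apply_le_apply_of_le hg (hle i)
          linarith [hCi i, hh _ (hv i)]
        · simpa [hj] using hga j
    refine (Finset.sum_le_sum fun s _ => hterm s).trans_eq ?_
    simp
    ring
  have hS0 : S v ≤ 0 := by
    have hpos : 0 < (2 : ℝ) ^ k * C ^ k := by positivity
    refine le_of_forall_pos_le_add fun ε hε => ?_
    have := hbound (ε / (2 ^ k * C ^ k)) (by positivity)
    rwa [div_mul_cancel₀ _ hpos.ne', ← zero_add ε] at this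
  simpa using hS0

theorem regNorm_le_of_nonneg {P : RegPoly k E} (hP : 0 ≤ P) {C : ℝ}
    (h : ∀ x, ‖x‖ ≤ 1 → |P x| ≤ C) : P.regNorm ≤ C :=
  (regNorm_le ((neg_nonpos.2 hP).trans hP) le_rfl).trans (supNorm_le h)

variable [HasSolidNorm E]

theorem sum_smul_apply {ι : Type*} (s : Finset ι) (a : ι → ℝ) (P : ι → RegPoly k E) (x : E) :
    (∑ i ∈ s, a i • P i) x = ∑ i ∈ s, a i * P i x := by
  have := map_sum (evalCLM k x) (fun i => a i • P i) s
  exact this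

/-- Positive combinations of the powers are controlled in norm by the same combinations of the `g
n`, so Mazur's theorem for `g` prevents `φ (P n)` from staying above `ε` infinitely often. -/
theorem weaklyNull_pow [CompleteSpace E] (hk : 1 ≤ k) {g : ℕ → E →L[ℝ] ℝ}
    (hg : ∀ n y, 0 ≤ y → 0 ≤ g n y) (hw : WeaklyNull g) :
    WeaklyNull fun n => ofPos (isPosHomPoly_pow k (hg n)) := by
  obtain ⟨M, hM, hgM⟩ := hw.exists_bound
  set P : ℕ → RegPoly k E := fun n => ofPos (isPosHomPoly_pow k (hg n))
  have hcomb : ∀ (r : ℕ → ℕ) (s : Finset ℕ) (a : ℕ → ℝ), (∀ i ∈ s, 0 ≤ a i) →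
      ‖∑ i ∈ s, a i • P (r i)‖ ≤ M ^ (k - 1) * ‖∑ i ∈ s, a i • g (r i)‖ := by
    intro r s a ha
    refine regNorm_le_of_nonneg (Finset.sum_nonneg fun i hi => ?_) fun x hx => ?_
    · simpa using smul_le_smul' (ofPos_nonneg (isPosHomPoly_pow k (hg (r i)))) (ha i hi)
    have hx' : ‖|x|‖ ≤ 1 := by rwa [norm_abs_eq_norm]
    rw [sum_smul_apply]
    calc |∑ i ∈ s, a i * P (r i) x| ≤ ∑ i ∈ s, |a i * P (r i) x| := Finset.abs_sum_le_sum_abs _ _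
      _ ≤ ∑ i ∈ s, M ^ (k - 1) * (a i * g (r i) |x|) := by
        refine Finset.sum_le_sum fun i hi => ?_
        have h0 := hg (r i) _ (abs_nonneg x)
        have h1 := abs_apply_le_apply_abs (hg (r i)) x
        have h2 : g (r i) |x| ≤ M :=
          (le_abs_self _).trans <| ((g (r i)).le_of_opNorm_le (hgM _) _).trans
          (mul_le_of_le_one_right hM.le hx')
        have h3 : |g (r i) x ^ k| ≤ M ^ (k - 1) * g (r i) |x| := by
          rw [abs_pow]
          calc |g (r i) x| ^ k ≤ (g (r i) |x|) ^ k := pow_le_pow_left₀ (abs_nonneg _) h1 k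
            _ = (g (r i) |x|) ^ (k - 1) * g (r i) |x| := by rw [← pow_succ, Nat.sub_add_cancel hk]
            _ ≤ M ^ (k - 1) * g (r i) |x| :=
              mul_le_mul_of_nonneg_right (pow_le_pow_left₀ h0 h2 _) h0
        rw [abs_mul, abs_of_nonneg (ha i hi), mul_left_comm]
        exact mul_le_mul_of_nonneg_left h3 (ha i hi)
      _ = M ^ (k - 1) * (∑ i ∈ s, a i • g (r i)) |x| := by
        rw [← Finset.mul_sum]
        simp
      _ ≤ M ^ (k - 1) * ‖∑ i ∈ s, a i • g (r i)‖ := by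
        refine mul_le_mul_of_nonneg_left ?_ (by positivity)
        exact (Real.le_norm_self _).trans ((ContinuousLinearMap.le_opNorm _ _).trans
          (mul_le_of_le_one_right (norm_nonneg _) hx'))
  have hlt : ∀ (φ : RegPoly k E →L[ℝ] ℝ) (ε : ℝ), 0 < ε → ∀ᶠ n in atTop, φ (P n) < ε := by
    intro φ ε hε
    by_contra hcon
    obtain ⟨r, hr, hbad⟩ := extraction_of_frequently_atTop (not_eventually.1 hcon)
    -- The summand `1` keeps `B` positive even when `φ = 0`.
    set B : ℝ := ‖φ‖ * M ^ (k - 1) + 1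
    have hB : 0 < B := by positivity
    obtain ⟨s, a, ha, ha1, hlt⟩ :=
      exists_convex_combination_norm_lt (hw.comp_strictMono hr) (div_pos hε hB)
    have h1 : ε ≤ φ (∑ i ∈ s, a i • P (r i)) := by
      rw [map_sum, ← one_mul ε, ← ha1, Finset.sum_mul]
      refine Finset.sum_le_sum fun i hi => ?_
      rw [map_smul, smul_eq_mul]
      exact mul_le_mul_of_nonneg_left (not_lt.1 (hbad i)) (ha i hi)
    have h2 := (h1.trans (le_abs_self _)).trans (φ.le_opNorm _)
    have h3 := mul_le_mul_of_nonneg_left (hcomb r s a ha) (norm_nonneg φ)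
    have h4 : ‖∑ i ∈ s, a i • g (r i)‖ < ε / B := hlt
    rw [lt_div_iff₀ hB] at h4
    have h5 := norm_nonneg (∑ i ∈ s, a i • g (r i))
    have h6 : ‖∑ i ∈ s, a i • g (r i)‖ * B =
      ‖φ‖ * (M ^ (k - 1) * ‖∑ i ∈ s, a i • g (r i)‖) + ‖∑ i ∈ s, a i • g (r i)‖ := by
        simp only [B]; ring
    linarith
  intro φ
  rw [Metric.tendsto_nhds]
  intro ε hε
  filter_upwards [hlt φ ε hε, hlt (-φ) ε hε] with n h₁ h₂
  rw [Real.dist_0_eq_abs, abs_lt]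
  rw [_root_.neg_apply] at h₂
  exact ⟨by linarith, h₁⟩

end RegPoly

end PowerPolynomials

/-! ### The space `c₀` over a discrete index set. -/

section DiscreteZeroAtInfty

variable {α : Type*} [TopologicalSpace α]

theorem ZeroAtInftyContinuousMap.norm_le_of_forall {F : C₀(α, ℝ)} {C : ℝ} (hC : 0 ≤ C)
    (h : ∀ a, |F a| ≤ C) : ‖F‖ ≤ C := by
  rw [← ZeroAtInftyContinuousMap.norm_toBCF_eq_norm]
  exact (BoundedContinuousFunction.norm_le hC).2 h

theorem ZeroAtInftyContinuousMap.abs_apply_le_norm (F : C₀(α, ℝ)) (a : α) : |F a| ≤ ‖F‖ := by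
  rw [← ZeroAtInftyContinuousMap.norm_toBCF_eq_norm]
  exact F.toBCF.norm_coe_le_norm a

variable [DiscreteTopology α]

/-- A family that vanishes at infinity on a discrete space, as an element of `C₀`. -/
def zeroAtInftyOfDiscrete (c : α → ℝ) (hc : Tendsto c cofinite (𝓝 0)) : C₀(α, ℝ) where
  toFun := c
  continuous_toFun := continuous_of_discreteTopology
  zero_at_infty' := by rwa [cocompact_eq_cofinite]

@[simp]
theorem zeroAtInftyOfDiscrete_apply (c : α → ℝ) (hc : Tendsto c cofinite (𝓝 0)) (a : α) :
    zeroAtInftyOfDiscrete c hc a = c a := rfl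

theorem tendsto_cofinite (F : C₀(α, ℝ)) : Tendsto F cofinite (𝓝 0) := by
  rw [← cocompact_eq_cofinite]
  exact zero_at_infty F

theorem finite_setOf_le_abs (F : C₀(α, ℝ)) {ε : ℝ} (hε : 0 < ε) : {a | ε ≤ |F a|}.Finite := by
  have h := (tendsto_cofinite F).abs.eventually_lt_const (u := ε) (by simpa using hε)
  simpa [eventually_cofinite] using h

open Classical in
/-- The unit vectors of `C₀(α, ℝ)`. -/
def unitVec (a : α) : C₀(α, ℝ) :=
  zeroAtInftyOfDiscrete (Pi.single a 1) (tendsto_const_nhds.congr' (by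
    filter_upwards [(Set.finite_singleton a).compl_mem_cofinite] with b hb
    exact (Pi.single_eq_of_ne (M := fun _ : α => ℝ) hb _).symm))

open Classical in
theorem unitVec_apply (a b : α) : unitVec a b = if b = a then 1 else 0 := by
  simp [unitVec, Pi.single_apply]

theorem sum_smul_unitVec_apply (s : Finset α) (c : α → ℝ) (b : α) [Decidable (b ∈ s)] :
    (∑ a ∈ s, c a • unitVec a) b = if b ∈ s then c b else 0 := by
  classical
  have h : ∀ t : Finset α, (∑ a ∈ t, c a • unitVec a) b = ∑ a ∈ t, c a * unitVec a b := by
    intro t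
    induction t using Finset.induction_on with
    | empty => simp
    | insert d t hd ih => rw [Finset.sum_insert hd, Finset.sum_insert hd, ← ih]; rfl
  rw [h]
  simp [unitVec_apply]

theorem hasSum_smul_unitVec (F : C₀(α, ℝ)) : HasSum (fun a => F a • unitVec a) F := by
  classical
  rw [HasSum, SummationFilter.unconditional_filter, Metric.tendsto_atTop]
  intro ε hε
  refine ⟨(finite_setOf_le_abs F (half_pos hε)).toFinset, fun s hs => ?_⟩
  rw [dist_eq_norm]
  refine (ZeroAtInftyContinuousMap.norm_le_of_forall (half_pos hε).le fun a => ?_).trans_lt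
    (half_lt_self hε)
  rw [ZeroAtInftyContinuousMap.sub_apply, sum_smul_unitVec_apply]
  split_ifs with ha
  · simpa using (half_pos hε).le
  · have : a ∉ {a | ε / 2 ≤ |F a|} := fun h => ha (hs (by simpa using h))
    simpa using (not_le.1 this).le

/-- Functionals on `c₀` are in `ℓ¹`: test on finite sign vectors, of norm at most one. -/
theorem summable_abs_apply_unitVec (l : C₀(α, ℝ) →L[ℝ] ℝ) : Summable fun a => |l (unitVec a)| := by
  classical
  refine summable_of_sum_le (c := ‖l‖) (fun _ => abs_nonneg _) fun s => ?_
  have h : ∑ a ∈ s, |l (unitVec a)| =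
      l (∑ a ∈ s, (SignType.sign (l (unitVec a)) : ℝ) • unitVec a) := by
    simp [map_sum]
  rw [h]
  refine (Real.le_norm_self _).trans ((l.le_opNorm _).trans
    (mul_le_of_le_one_right (norm_nonneg l) ?_))
  refine ZeroAtInftyContinuousMap.norm_le_of_forall zero_le_one fun a => ?_
  rw [sum_smul_unitVec_apply]
  split_ifs
  · rcases SignType.trichotomy (SignType.sign (l (unitVec a))) with e | e | e <;> simp [e]
  · simp

/-- Below `x₀` only finitely many coordinates can reach `ε / 2`, and directedness makes all of these
small at once. -/
theorem orderContinuousNorm_zeroAtInfty : OrderContinuousNorm C₀(α, ℝ) := by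
  classical
  intro D ⟨x₀, hx₀⟩ hdir hglb ε hε
  have hpos : ∀ x ∈ D, ∀ a, 0 ≤ x a := fun x hx a => hglb.1 hx a
  have hsmall : ∀ a, ∃ x ∈ D, x a < ε / 2 := by
    intro a
    by_contra! hcon
    have hlb : (ε / 2) • unitVec a ∈ lowerBounds D := by
      intro x hx b
      change ε / 2 * unitVec a b ≤ x b
      rw [unitVec_apply]
      split_ifs with hb
      · subst hb
        simpa using hcon x hx
      · simpa using hpos x hx b
    have h := hglb.2 hlb a
    change ε / 2 * unitVec a a ≤ 0 at h
    rw [unitVec_apply, if_pos rfl] at h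
    linarith
  have hfin : ∀ s : Finset α, ∃ x ∈ D, x ≤ x₀ ∧ ∀ a ∈ s, x a < ε / 2 := by
    intro s
    induction s using Finset.induction_on with
    | empty => exact ⟨x₀, hx₀, le_rfl, by simp⟩
    | insert a s _ ih =>
      obtain ⟨x, hx, hxx₀, hxs⟩ := ih
      obtain ⟨y, hy, hya⟩ := hsmall a
      obtain ⟨z, hz, hzx, hzy⟩ := hdir x hx y hy
      have hzx : z ≤ x := hzx
      have hzy : z ≤ y := hzy
      refine ⟨z, hz, hzx.trans hxx₀, fun b hb => ?_⟩
      rcases Finset.mem_insert.1 hb with rfl | hb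
      · exact (hzy b).trans_lt hya
      · exact (hzx b).trans_lt (hxs b hb)
  obtain ⟨x, hx, hxx₀, hxs⟩ := hfin (finite_setOf_le_abs x₀ (half_pos hε)).toFinset
  refine ⟨x, hx, (ZeroAtInftyContinuousMap.norm_le_of_forall (half_pos hε).le fun a => ?_).trans_lt
    (half_lt_self hε)⟩
  rw [abs_of_nonneg (hpos x hx a)]
  by_cases ha : ε / 2 ≤ |x₀ a|
  · exact (hxs a (by simpa using ha)).le
  · exact (hxx₀ a).trans ((le_abs_self _).trans (not_le.1 ha).le)

end DiscreteZeroAtInfty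

/-! ### The power polynomial into `c₀`. -/

section PowerSequence

variable {α : Type*} [TopologicalSpace α] [DiscreteTopology α] (e : α ≃ ℕ)
  {E : Type*} [NormedAddCommGroup E] [NormedSpace ℝ E]

/-- The null sequence `d`, reindexed by `α`. -/
def zeroAtInftyOfSeq (d : ℕ → ℝ) (hd : Tendsto d atTop (𝓝 0)) : C₀(α, ℝ) :=
  zeroAtInftyOfDiscrete (d ∘ e)
    (hd.comp (by rw [← Nat.cofinite_eq_atTop]; exact e.injective.tendsto_cofinite))

@[simp]
theorem zeroAtInftyOfSeq_apply (d : ℕ → ℝ) (hd : Tendsto d atTop (𝓝 0)) (a : α) :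
    zeroAtInftyOfSeq e d hd a = d (e a) := rfl

theorem tendsto_pow_zero {d : ℕ → ℝ} (hd : Tendsto d atTop (𝓝 0)) {k : ℕ} (hk : 1 ≤ k) :
    Tendsto (fun n => d n ^ k) atTop (𝓝 0) := by
  simpa [Nat.one_le_iff_ne_zero.1 hk] using hd.pow k

theorem WeaklyNull.tendsto_apply {g : ℕ → E →L[ℝ] ℝ} (hw : WeaklyNull g) (x : E) :
    Tendsto (fun n => g n x) atTop (𝓝 0) :=
  hw (NormedSpace.inclusionInDoubleDual ℝ E x)

theorem WeaklyNull.tendsto_powForm {g : ℕ → E →L[ℝ] ℝ} (hw : WeaklyNull g) {k : ℕ} (hk : 1 ≤ k)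
    (v : Fin k → E) : Tendsto (fun n => powForm k (g n) v) atTop (𝓝 0) := by
  have := tendsto_finsetProd (Finset.univ : Finset (Fin k)) fun i _ => hw.tendsto_apply (v i)
  simpa [Nat.one_le_iff_ne_zero.1 hk] using this

variable {g : ℕ → E →L[ℝ] ℝ} (hw : WeaklyNull g) {k : ℕ} (hk : 1 ≤ k)

/-- The polynomial `x ↦ (g n x ^ k)ₙ` with values in `c₀`. -/
def powSeq (x : E) : C₀(α, ℝ) :=
  zeroAtInftyOfSeq e (fun n => g n x ^ k) (tendsto_pow_zero (hw.tendsto_apply x) hk)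

/-- A polynomial `powSeq` that is disjoint `p`-convergent forces `g n (x n) → 0`. -/
theorem tendsto_of_disjointPConvergent_powSeq [Lattice E] {p : ℝ}
    (hg : ∀ n y, 0 ≤ y → 0 ≤ g n y) (H : DisjointPConvergent p (powSeq (α := α) e hw hk))
    {x : ℕ → E} (hx0 : ∀ n, 0 ≤ x n) (hd : DisjointSeq x) (hx : WeaklyPSummable p x) :
    Tendsto (fun n => g n (x n)) atTop (𝓝 0) := by
  refine tendsto_zero_of_pow (fun n => hg n _ (hx0 n)) (k := k) ?_
  refine squeeze_zero_norm (fun n => ?_) (tendsto_zero_iff_norm_tendsto_zero.1 (H x hd hx))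
  have := (powSeq (α := α) e hw hk (x n)).abs_apply_le_norm (e.symm n)
  simpa [powSeq] using this

variable [CompleteSpace E]

theorem exists_powSeq_form {g : ℕ → E →L[ℝ] ℝ} (hw : WeaklyNull g) {k : ℕ} (hk : 1 ≤ k) :
    ∃ T : ContinuousMultilinearMap ℝ (fun _ : Fin k => E) C₀(α, ℝ),
    ∀ v a, T v a = powForm k (g (e a)) v := by
  obtain ⟨M, hM, hgM⟩ := hw.exists_bound
  refine ⟨MultilinearMap.mkContinuous
    { toFun := fun v => zeroAtInftyOfSeq e (fun n => powForm k (g n) v) (hw.tendsto_powForm hk v)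
      map_update_add' := fun v i x y => ?_
      map_update_smul' := fun v i c x => ?_ } (M ^ k) fun v => ?_, fun v a => rfl⟩
  · ext a
    exact (powForm k (g (e a))).map_update_add v i x y
  · ext a
    exact (powForm k (g (e a))).map_update_smul v i c x
  · refine ZeroAtInftyContinuousMap.norm_le_of_forall (by positivity) fun a => ?_
    change |powForm k (g (e a)) v| ≤ _
    rw [powForm_apply, Finset.abs_prod]
    refine (Finset.prod_le_prod (fun i _ => abs_nonneg _) fun i _ =>
      (g (e a)).le_of_opNorm_le (hgM _) (v i)).trans_eq ?_
    simp [Finset.prod_mul_distrib]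

theorem isPosHomPoly_powSeq [Lattice E] (hg : ∀ n y, 0 ≤ y → 0 ≤ g n y) :
    IsPosHomPoly k (powSeq e hw hk) := by
  obtain ⟨T, hT⟩ := exists_powSeq_form e hw hk
  refine ⟨T, fun σ v => ?_, fun v hv a => ?_, fun x => ?_⟩
  · ext a
    rw [hT, hT, powForm_perm]
  · change 0 ≤ T v a
    rw [hT, powForm_apply]
    exact Finset.prod_nonneg fun i _ => hg _ _ (hv i)
  · ext a
    rw [hT, powForm_apply]
    simp [powSeq]

/-- The map extends to the bidual ball by `φ ↦ (φ (g n) ^ k)`, still with values in `c₀` because `g`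
is weakly null. The extension is weak-star to weak continuous, so its compact image contains that of
the ball. -/
theorem weaklyCompactMap_powSeq : WeaklyCompactMap (powSeq (α := α) e hw hk) := by
  obtain ⟨M, hM, hgM⟩ := hw.exists_bound
  let Ξ : WeakDual ℝ (E →L[ℝ] ℝ) → C₀(α, ℝ) := fun φ => zeroAtInftyOfSeq e
    (fun n => φ (g n) ^ k) (tendsto_pow_zero (hw (WeakDual.toStrongDual φ)) hk)
  have hΞ : ∀ φ a, Ξ φ a = φ (g (e a)) ^ k := fun _ _ => rfl
  set B := WeakDual.toStrongDual ⁻¹' Metric.closedBall (0 : StrongDual ℝ (E →L[ℝ] ℝ)) 1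
  have hcont : ContinuousOn (fun φ => toWeakSpace ℝ C₀(α, ℝ) (Ξ φ)) B := by
    rw [continuousOn_iff_continuous_domRestrict]
    refine WeakBilin.continuous_of_continuous_eval _ fun l => ?_
    change Continuous (B.domRestrict fun φ => l (Ξ φ))
    rw [← continuousOn_iff_continuous_domRestrict]
    -- As `l` is in `ℓ¹`, this series is dominated on `B` by `M ^ k * |l (unitVec a)|`, so its sum
    -- is continuous.
    have hsum : ∀ φ, l (Ξ φ) = ∑' a : α, φ (g (e a)) ^ k * l (unitVec a) := fun φ => by
      have := (l.hasSum (hasSum_smul_unitVec (Ξ φ))).tsum_eq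
      simpa [hΞ] using this.symm
    simp only [hsum]
    refine continuousOn_tsum (u := fun a => M ^ k * |l (unitVec a)|) (fun a => ?_)
      ((summable_abs_apply_unitVec l).mul_left _) fun a φ hφ => ?_
    · exact (((WeakDual.eval_continuous (g (e a))).pow k).mul_const _).continuousOn
    · rw [norm_mul, norm_pow]
      refine mul_le_mul_of_nonneg_right (pow_le_pow_left₀ (norm_nonneg _) ?_ k) (norm_nonneg _)
      have hφ' : ‖WeakDual.toStrongDual φ‖ ≤ 1 :=
        (dist_zero_right (WeakDual.toStrongDual φ)).ge.trans hφ
      exact ((WeakDual.toStrongDual φ).le_of_opNorm_le hφ' (g (e a))).trans (by simpa using hgM _)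
  refine ((WeakDual.isCompact_closedBall (𝕜 := ℝ) (E := E →L[ℝ] ℝ) 0 1).image_of_continuousOn
    hcont).closure_of_subset ?_
  rintro _ ⟨_, ⟨x, hx, rfl⟩, rfl⟩
  refine ⟨StrongDual.toWeakDual (NormedSpace.inclusionInDoubleDual ℝ E x), ?_, rfl⟩
  simpa using (NormedSpace.double_dual_bound ℝ E x).trans (by simpa using hx)

end PowerSequence

end

/-! ### The cycle of implications. -/

theorem theorem4p3 (E : Type*) [NormedAddCommGroup E] [NormedSpace ℝ E] [CompleteSpace E]
    [Lattice E] [IsOrderedAddMonoid E] [IsOrderedModule ℝ E] [HasSolidNorm E]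
    (k : ℕ) (hk : 1 ≤ k) (p : ℝ) (hp : 1 ≤ p) :
    List.TFAE [
      DisjointDPP p E,
      ∀ (F : Type*) [NormedAddCommGroup F] [NormedSpace ℝ F] [CompleteSpace F] [Lattice F]
        [IsOrderedAddMonoid F] [IsOrderedModule ℝ F] [HasSolidNorm F], OrderContinuousNorm F →
        ∀ P : E → F, IsPosHomPoly k P → WeaklyCompactMap P → DisjointPConvergent p P,
      ∀ P : E → C₀(ℕ, ℝ), IsPosHomPoly k P → WeaklyCompactMap P → DisjointPConvergent p P,
      ∀ (x : ℕ → E) (P : ℕ → RegPoly k E), DisjointSeq x → WeaklyPSummable p x →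
        (∀ n, 0 ≤ P n) → WeaklyNull P →
        Tendsto (fun n => P n (x n)) atTop (𝓝 0),
      ∀ (x : ℕ → E) (P : ℕ → RegPoly k E), DisjointSeq x → WeaklyPSummable p x →
        (∀ n, 0 ≤ P n) → RegPoly.DisjointSeq P → WeaklyNull P →
        Tendsto (fun n => P n (x n)) atTop (𝓝 0),
      ∀ (x : ℕ → E) (P : ℕ → RegPoly k E), DisjointSeq x → WeaklyPSummable p x →
        RegPoly.DisjointSeq P → WeaklyNull P →
        Tendsto (fun n => P n (x n)) atTop (𝓝 0)]  := by
  have hp0 : 0 < p := zero_lt_one.trans_le hp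
  tfae_have 1 → 4 := fun h x P hd hx _ hP => h.tendsto_regPoly hp0 hk hd hx hP
  tfae_have 1 → 6 := fun h x P hd hx _ hP => h.tendsto_regPoly hp0 hk hd hx hP
  tfae_have 4 → 5 := fun h x P hd hx hP0 _ hP => h x P hd hx hP0 hP
  tfae_have 6 → 5 := fun h x P hd hx _ hPd hP => h x P hd hx hPd hP
  tfae_have 5 → 1 := fun h => disjointDPP_of_positive hp0.le fun x g hd hx hx0 hg hw hgd =>
    tendsto_zero_of_pow (fun n => hg n _ (hx0 n)) <|
      h x (fun n => RegPoly.ofPos (isPosHomPoly_pow k (hg n))) hd hx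
        (fun n => RegPoly.ofPos_nonneg _)
        (fun m n hmn => ⟨_, _, RegPoly.isAbs_self (RegPoly.ofPos_nonneg _),
          RegPoly.isAbs_self (RegPoly.ofPos_nonneg _),
          RegPoly.isGLB_pow_of_disjoint hk (hg m) (hg n) (hgd m n hmn)⟩)
        (RegPoly.weaklyNull_pow hk hg hw)
  tfae_have 1 → 2 := fun h F _ _ _ _ _ _ _ _ P hP hPc => h.disjointPConvergent hp0 hk hP hPc
  tfae_have 1 → 3 := fun h P hP hPc => h.disjointPConvergent hp0 hk hP hPc
  tfae_have 2 → 1 := fun h => disjointDPP_of_positive hp0.le fun x g hd hx hx0 hg hw _ =>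
    -- `F` ranges over a fixed but arbitrary universe, so `c₀` is indexed by `ULift ℕ` to lie in it.
    tendsto_of_disjointPConvergent_powSeq (α := ULift ℕ) Equiv.ulift hw hk hg
      (h _ orderContinuousNorm_zeroAtInfty _ (isPosHomPoly_powSeq Equiv.ulift hw hk hg)
        (weaklyCompactMap_powSeq Equiv.ulift hw hk)) hx0 hd hx
  tfae_have 3 → 1 := fun h => disjointDPP_of_positive hp0.le fun x g hd hx hx0 hg hw _ =>
    tendsto_of_disjointPConvergent_powSeq (Equiv.refl ℕ) hw hk hg
      (h _ (isPosHomPoly_powSeq (Equiv.refl ℕ) hw hk hg)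
        (weaklyCompactMap_powSeq (Equiv.refl ℕ) hw hk)) hx0 hd hx
  tfae_finish
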